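/- **Setting.** Let $1\le m\le K-1$ be integers, $\mu>0$ and $0<\rho<1$. One observes i.i.d. random vectors $\mathbf X_n=(X_{1n},\dots,X_{Kn})$, $n=1,2,\dots$ ($K$ data streams). For $\mathcal A\subseteq[K]=\{1,\dots,K\}$ let $\mathbb P_{\mathcal A}$ (expectation $\mathbb E_{\mathcal A}$) be the law of the data under which $\mathbf X_n$ is multivariate normal with mean $\mu$ in the coordinates $i\in\mathcal A$ and $0$ in the other coordinates, and with covariance matrix having $1$ on the diagonal and $\rho$ off the diagonal. In stream $i$ the null hypothesis is that the mean is $0$, the alternative that it is $\mu$. Let $\mathcal P_m=\{\mathcal A\subseteq[K]:|\mathcal A|=m\}$ and let $\mathcal S_n$ be the $\sigma$-field generated by $\mathbf X_1,\dots,\mathbf X_n$. A *sequential test* is a pair $(T,d)$ with $T$ an $\{\mathcal S_n\}$-stopping time with values in $\{1,2,\dots\}\cup\{\infty\}$ and $d$ an $\mathcal S_T$-measurable vector in $\{0,1\}^K$; put $\mathcal D=\{i:d_i=1\}$ (the rejected nulls), $V=|\mathcal D\setminus\mathcal A|$, $W=|\mathcal A\setminus\mathcal D|$, $R=|\mathcal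 D|$, and $$FWER_{1,\mathcal A}(T,d)=\mathbb P_{\mathcal A}(V\ge1),\qquad FWER_{2,\mathcal A}(T,d)=\mathbb P_{\mathcal A}(W\ge1).$$ A *multiple testing error metric* is a pair $\mathrm{MTE}=(\mathrm{MTE}_1,\mathrm{MTE}_2)$ of functions that assign to every sequential test $(T,d)$ and every $\mathcal A$ real numbers $\mathrm{MTE}_{i,\mathcal A}(T,d)$ (for instance in $[0,1]$), and $$\Delta^{\mathrm{MTE}}_{\alpha,\beta}(\mathcal P_m)=\{(T,d):\ \mathrm{MTE}_{1,\mathcal A}(T,d)\le\alpha\text{ and }\mathrm{MTE}_{2,\mathcal A}(T,d)\le\beta\text{ for all }\mathcal A\in\mathcal P_m\}.$$ Let $S_{i,n}=\sum_{j=1}^nX_{ij}$ and let $S_{(1)}(n)\ge\dots\ge S_{(K)}(n)$ be the ordered values of $S_{1,n},\dots,S_{K,n}$. The *gap rule* $(T^\star_{Gap}(c),d^\star_{Gap}(c))$ with threshold $c$ stops at $$T^\star_{Gap}(c)=\inf\Big\{n\ge1:\ S_{(m)}(n)-S_{(m+1)}(n)\ge\frac{1-\rho}{\mu}\,c\Big\}\qquad(\inf\emptyset=\infty)$$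 and then rejects the nulls of the $m$ streams with the largest sums. For functions $x,y$ of $(\alpha,\beta)$ with values in $[0,\infty]$, $x\sim y$ means $x/y\to1$ as $\alpha,\beta\downarrow0$ in an arbitrary way. **Theorem.** Let MTE be a multiple testing error metric for which there are constants $C_1,C_2>0$ such that (i) $\mathrm{MTE}_{i,\mathcal A}(T^\star_{Gap}(c),d^\star_{Gap}(c))\le C_1\cdot FWER_{i,\mathcal A}(T^\star_{Gap}(c),d^\star_{Gap}(c))$ for $i=1,2$, all $\mathcal A\in\mathcal P_m$ and all $c>0$; (ii) $\mathrm{MTE}_{i,\mathcal A}(T,d)\ge C_2\cdot FWER_{i,\mathcal A}(T,d)$ for $i=1,2$, all $\mathcal A\in\mathcal P_m$ and all sequential tests $(T,d)$. For $\alpha,\beta\in(0,1)$ let $(T'_{Gap},d'_{Gap})$ be the gap rule with threshold $$c=\big|\log\big((\alpha/C_1)\wedge(\beta/C_1)\big)\big|+\log(m(K-m)).$$ Then: (1) $(T'_{Gap},d'_{Gap})\in\Delta^{\mathrm{MTE}}_{\alpha,\beta}(\mathcal P_m)$ for all $\alpha,\beta\in(0,1)$ for which this threshold is positive (it always is, unless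 $K=2$ and $\alpha\wedge\beta=C_1$); (2) for every $\mathcal A\in\mathcal P_m$, as $\alpha,\beta\to0$, $$\mathbb E_{\mathcal A}[T'_{Gap}]\ \sim\ \frac{1-\rho}{\mu^2}\,|\log(\alpha\wedge\beta)|\ \sim\ \inf_{(T,d)\in\Delta^{\mathrm{MTE}}_{\alpha,\beta}(\mathcal P_m)}\mathbb E_{\mathcal A}[T],$$ so that also $\mathbb E_{\mathcal A}[T'_{Gap}]\sim\inf_{(T,d)\in\Delta^{\mathrm{MTE}}_{\alpha,\beta}(\mathcal P_m)}\mathbb E_{\mathcal A}[T]$. Moreover, conditions (i) and (ii) hold with $C_1=1$, $C_2=1/K$ for $(FDR,FNR)$ and for $(pFDR,pFNR)$, where $$FDR=\mathbb E_{\mathcal A}\Big[\frac{V}{R\vee1}\Big],\quad FNR=\mathbb E_{\mathcal A}\Big[\frac{W}{(K-R)\vee1}\Big],\quad pFDR=\mathbb E_{\mathcal A}\Big[\frac VR\,\Big|\,R\ge1\Big],\quad pFNR=\mathbb E_{\mathcal A}\Big[\frac W{K-R}\,\Big|\,K-R\ge1\Big]$$ (a conditional expectation given an event of probability $0$ is read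 as $0$). -/

import Mathlib

open MeasureTheory ProbabilityTheory Filter Topology
open scoped ENNReal

namespace SeqMTE

noncomputable section

/-- The space of sample paths: `ω j` is the vector of the `(j+1)`-st observations of the `K`
streams, so that `ω 0, …, ω (n-1)` are the first `n` observations. -/
abbrev Path (K : ℕ) : Type := ℕ → EuclideanSpace ℝ (Fin K)

/-- The `K × K` matrix with `1` on the diagonal and `ρ` off the diagonal. -/
def equicorr (K : ℕ) (ρ : ℝ) : Matrix (Fin K) (Fin K) ℝ :=
  Matrix.of fun i j => if i = j then 1 else ρ

/-- The mean vector: `μ` in the streams of `A` (signals), `0` in the other streams (noise). -/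
def meanVec {K : ℕ} (μ : ℝ) (A : Finset (Fin K)) : EuclideanSpace ℝ (Fin K) :=
  WithLp.toLp 2 fun i => if i ∈ A then μ else 0

/-- The law of the data when `A` is the set of signals: the observation vectors at different times
are independent, each multivariate normal with mean `meanVec μ A` and covariance `equicorr K ρ`. -/
def law {K : ℕ} (μ ρ : ℝ) (A : Finset (Fin K)) : Measure (Path K) :=
  Measure.infinitePi fun _ : ℕ => multivariateGaussian (meanVec μ A) (equicorr K ρ)

/-- The filtration whose `n`-th σ-field is generated by the first `n` observations in all streams. -/
def dataFiltration (K : ℕ) : Filtration ℕ (inferInstance : MeasurableSpace (Path K)) where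
  seq n := ⨆ j < n, MeasurableSpace.comap (fun ω : Path K => ω j) inferInstance
  mono' _ _ h := biSup_mono fun _ hj => lt_of_lt_of_le hj h
  le' _ := iSup₂_le fun j _ => (measurable_pi_apply j).comap_le

/-- The data of a multiple testing procedure: the time `T` at which sampling stops in all streams
(`⊤` if it never stops), and the set `D` of streams in which the alternative is selected. -/
structure Procedure (K : ℕ) where
  T : Path K → WithTop ℕ
  D : Path K → Finset (Fin K)

/-- A sequential test: `T ≥ 1` is a stopping time of the data filtration, and the decision in each
stream is measurable with respect to the σ-field of events up to time `T`. -/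
def IsSequentialTest {K : ℕ} (p : Procedure K) : Prop :=
  (∀ ω, 1 ≤ p.T ω) ∧
    ∃ hT : IsStoppingTime (dataFiltration K) p.T,
      ∀ i, MeasurableSet[hT.measurableSpace] {ω | i ∈ p.D ω}

/-- The expected sample size under the signal set `A`, with values in `[0, ∞]`. -/
def expectedSampleSize {K : ℕ} (μ ρ : ℝ) (A : Finset (Fin K)) (p : Procedure K) : ℝ≥0∞ :=
  ∫⁻ ω, ENat.toENNReal (p.T ω) ∂(law μ ρ A)

/-- The partial sum of the first `n` observations in stream `i`. -/
def partialSum {K : ℕ} (n : ℕ) (ω : Path K) (i : Fin K) : ℝ :=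
  ∑ j ∈ Finset.range n, ω j i

/-- A permutation listing the streams by decreasing value of the statistics `s`. -/
def ranking {K : ℕ} (s : Fin K → ℝ) : Equiv.Perm (Fin K) :=
  Tuple.sort fun i => -s i

/-- The order statistic `s_(k)`, the `k`-th largest value of `s` (for `1 ≤ k ≤ K`). -/
def orderStat {K : ℕ} (s : Fin K → ℝ) (k : ℕ) : ℝ :=
  if h : 1 ≤ k ∧ k ≤ K then s (ranking s ⟨k - 1, by omega⟩) else 0

/-- The `m` streams with the largest values of `s`. -/
def topStreams {K : ℕ} (m : ℕ) (s : Fin K → ℝ) : Finset (Fin K) :=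
  {i | ((ranking s).symm i : ℕ) < m}

/-- The stopping time of the gap rule: the first `n ≥ 1` at which
`S_(m) - S_(m+1) ≥ (1 - ρ) / μ * c`, and `⊤` if there is none. -/
def gapTime (K m : ℕ) (μ ρ c : ℝ) : Path K → WithTop ℕ :=
  hittingAfter
    (fun n ω => orderStat (partialSum n ω) m - orderStat (partialSum n ω) (m + 1))
    (Set.Ici ((1 - ρ) / μ * c)) 1

/-- The gap rule: stop at `gapTime`, and select the alternative in the `m` streams with the largest
sums at that time (on the event that it never stops the decision does not depend on the path). -/
def gapRule (K m : ℕ) (μ ρ c : ℝ) : Procedure K where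
  T := gapTime K m μ ρ c
  D ω := topStreams m (partialSum ((gapTime K m μ ρ c ω).untopD 0) ω)

/-- A multiple testing error metric: its type 1 and type 2 versions, each assigning a real number
to a set of true signals and a procedure. -/
structure ErrorMetric (K : ℕ) where
  type1 : Finset (Fin K) → Procedure K → ℝ
  type2 : Finset (Fin K) → Procedure K → ℝ

/-- The number of true null hypotheses rejected. -/
def falseRejections {K : ℕ} (A : Finset (Fin K)) (p : Procedure K) (ω : Path K) : ℕ :=
  (p.D ω \ A).card

/-- The number of false null hypotheses accepted. -/
def falseAcceptances {K : ℕ} (A : Finset (Fin K)) (p : Procedure K) (ω : Path K) : ℕ :=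
  (A \ p.D ω).card

/-- The number of null hypotheses rejected. -/
def rejections {K : ℕ} (p : Procedure K) (ω : Path K) : ℕ :=
  (p.D ω).card

/-- The two familywise error rates. -/
def FWER (K : ℕ) (μ ρ : ℝ) : ErrorMetric K where
  type1 A p := (law μ ρ A).real {ω | 1 ≤ falseRejections A p ω}
  type2 A p := (law μ ρ A).real {ω | 1 ≤ falseAcceptances A p ω}

/-- The false discovery rate and the false non-discovery rate. -/
def FDR_FNR (K : ℕ) (μ ρ : ℝ) : ErrorMetric K where
  type1 A p := ∫ ω, (falseRejections A p ω : ℝ) / max (rejections p ω : ℝ) 1 ∂(law μ ρ A)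
  type2 A p :=
    ∫ ω, (falseAcceptances A p ω : ℝ) / max ((K : ℝ) - (rejections p ω : ℝ)) 1 ∂(law μ ρ A)

/-- The positive false discovery rate and the positive false non-discovery rate: expectations under
the law conditioned on at least one rejection, respectively at least one acceptance. They are `0` if
the conditioning event has probability `0`. -/
def pFDR_pFNR (K : ℕ) (μ ρ : ℝ) : ErrorMetric K where
  type1 A p :=
    ∫ ω, (falseRejections A p ω : ℝ) / (rejections p ω : ℝ)
      ∂(cond (law μ ρ A) {ω | 1 ≤ rejections p ω})
  type2 A p :=
    ∫ ω, (falseAcceptances A p ω : ℝ) / ((K : ℝ) - (rejections p ω : ℝ))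
      ∂(cond (law μ ρ A) {ω | 1 ≤ (K : ℝ) - (rejections p ω : ℝ)})

/-- The class of signal sets with exactly `m` elements. -/
def signalClass (K m : ℕ) : Set (Finset (Fin K)) := {A | A.card = m}

/-- The sequential tests that control the metric at levels `α`, `β` for all signal sets in `P`. -/
def controlClass {K : ℕ} (M : ErrorMetric K) (P : Set (Finset (Fin K))) (α β : ℝ) :
    Set (Procedure K) :=
  {p | IsSequentialTest p ∧ ∀ A ∈ P, M.type1 A p ≤ α ∧ M.type2 A p ≤ β}

/-- On the gap rules with thresholds `c > 0` the metric is at most `C` times the FWER. -/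
def GapRuleUpperBound (K m : ℕ) (μ ρ : ℝ) (M : ErrorMetric K) (C : ℝ) : Prop :=
  ∀ A ∈ signalClass K m, ∀ c : ℝ, 0 < c →
    M.type1 A (gapRule K m μ ρ c) ≤ C * (FWER K μ ρ).type1 A (gapRule K m μ ρ c) ∧
    M.type2 A (gapRule K m μ ρ c) ≤ C * (FWER K μ ρ).type2 A (gapRule K m μ ρ c)

/-- On all sequential tests the metric is at least `C` times the FWER. -/
def UniversalLowerBound (K m : ℕ) (μ ρ : ℝ) (M : ErrorMetric K) (C : ℝ) : Prop :=
  ∀ A ∈ signalClass K m, ∀ p : Procedure K, IsSequentialTest p →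
    C * (FWER K μ ρ).type1 A p ≤ M.type1 A p ∧ C * (FWER K μ ρ).type2 A p ≤ M.type2 A p

/-- The threshold `|log ((α / C) ∧ (β / C))| + log (m (K - m))`. -/
def threshold (K m : ℕ) (C α β : ℝ) : ℝ :=
  |Real.log (min (α / C) (β / C))| + Real.log ((m : ℝ) * ((K : ℝ) - (m : ℝ)))

/-- `x ∼ y` as `α, β → 0` through positive values, in any way: `x / y → 1`. -/
def AsympEquiv (x y : ℝ → ℝ → ℝ≥0∞) : Prop :=
  Tendsto (fun q : ℝ × ℝ => x q.1 q.2 / y q.1 q.2) (𝓝[>] 0 ×ˢ 𝓝[>] 0) (𝓝 1)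

end

end SeqMTE

open SeqMTE

/-! Everything rests on one likelihood ratio. Replacing a signal `i` by a noise stream `j` moves the
mean along the contrast `e_j - e_i`, an eigenvector of the equicorrelation matrix with eigenvalue `1
- ρ`. By Cameron–Martin the likelihood ratio of `n` observations is therefore `exp (μ / (1 - ρ) *
(S_j - S_i))`, and `law_swapSignal_stopped` carries this over to stopping times. The gap rule thus
stops when the relevant log-likelihood ratios reach `c`.

Errors of the gap rule: a wrong decision puts some noise stream above some signal by at least the
threshold. Computed under the swapped law, each such inversion has probability at most `exp (-c)`,
and there are `m (K - m)` pairs (`law_gapRule_ne_le`); this explains the additive logarithm in the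
threshold.

Its sample size: every signal-minus-noise sum has drift `μ`, and the rule must have stopped once all
of them exceed the threshold. Gaussian tails then give an expectation of at most `(1 - ρ) c / (μ (μ
- δ))` plus a constant free of `c` (`expectedSampleSize_gapRule_le`).

Lower bound for any test: by (ii) it controls both familywise errors at levels `α / C₂`, `β / C₂`.
The event of selecting exactly `A` is likely under `A`, but an error of both types after a swap. The
information inequality bounds the expected log-likelihood ratio from below, and Wald's identity
equates that expectation to `μ ^ 2 / (1 - ρ)` times the expected sample size
(`information_lower_bound`).

The constants of the metric change the logarithm only by a bounded amount, so both bounds have the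
same leading term; the gap rule eventually lies in the class, so the infimum is squeezed between
them. For the discovery rates, the error proportion lies between `1 / K` and `1` whenever an error
occurs. -/

open scoped RealInnerProductSpace MatrixOrder

namespace SeqMTE

/-! ### Densities of product and Gaussian measures -/

/-- Densities in finitely many coordinates of a product of probability measures. -/
theorem infinitePi_withDensity {ι : Type*} {X : ι → Type*} [∀ i, MeasurableSpace (X i)]
    (P Q : ∀ i, Measure (X i)) [∀ i, IsProbabilityMeasure (P i)] [∀ i, IsProbabilityMeasure (Q i)]
    (s : Finset ι) (f : ∀ i, X i → ℝ≥0∞) (hf : ∀ i, Measurable (f i))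
    (hs : ∀ i ∈ s, Q i = (P i).withDensity (f i)) (hs' : ∀ i ∉ s, Q i = P i) :
    (Measure.infinitePi P).withDensity (fun x => ∏ i ∈ s, f i (x i)) = Measure.infinitePi Q := by
  classical
  refine Measure.eq_infinitePi Q fun u t ht => ?_
  have hbox : MeasurableSet (Set.pi (u : Set ι) t) :=
    MeasurableSet.pi u.countable_toSet fun i _ => ht i
  rw [withDensity_apply _ hbox, ← lintegral_indicator hbox]
  -- Padding with ones turns the density over `s` and the indicator of the box over `u` into a
  -- single product over `s ∪ u`, to which independence applies.
  let g : ∀ i, X i → ℝ≥0∞ := fun i x =>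
    (if i ∈ s then f i x else 1) * (if i ∈ u then (t i).indicator 1 x else 1)
  have hg : ∀ i, Measurable (g i) := by
    intro i
    refine Measurable.mul ?_ ?_
    · split_ifs
      exacts [hf i, measurable_const]
    · split_ifs
      exacts [measurable_one.indicator (ht i), measurable_const]
  have key : ∀ x : (∀ i, X i), (Set.pi (u : Set ι) t).indicator
      (fun x => ∏ i ∈ s, f i (x i)) x = ∏ i ∈ s ∪ u, g i (x i) := by
    intro x
    simp only [g, Finset.prod_mul_distrib]
    rw [Finset.prod_ite_mem, Finset.prod_ite_mem, Finset.union_inter_cancel_left,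
      Finset.union_inter_cancel_right]
    by_cases hx : x ∈ Set.pi (u : Set ι) t
    · rw [Set.indicator_of_mem hx, Finset.prod_eq_one (s := u), mul_one]
      intro i hi
      rw [Set.indicator_of_mem (hx i hi)]
      rfl
    · rw [Set.indicator_of_notMem hx]
      simp only [Set.mem_pi, not_forall] at hx
      obtain ⟨i, hi, hxi⟩ := hx
      rw [Finset.prod_eq_zero (s := u) hi, mul_zero]
      exact Set.indicator_of_notMem hxi _
  simp_rw [key]
  have hprod := lintegral_prod_eq_prod_lintegral_of_indepFun (μ := Measure.infinitePi P) (s ∪ u)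
    (fun i (x : ∀ i, X i) => g i (x i)) (iIndepFun_infinitePi hg) (fun i => (hg i).comp (measurable_pi_apply i))
  rw [hprod]
  have hint : ∀ i, ∫⁻ x, g i (x i) ∂(Measure.infinitePi P) = if i ∈ u then Q i (t i) else 1 := by
    intro i
    have h1 : ∫⁻ x, g i (x i) ∂(Measure.infinitePi P) = ∫⁻ y, g i y ∂(P i) := by
      rw [← (measurePreserving_eval_infinitePi P i).lintegral_comp (hg i)]
    have h2 : ∫⁻ y, g i y ∂(P i) = ∫⁻ y, (if i ∈ u then (t i).indicator 1 y else 1) ∂(Q i) := by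
      have hm : Measurable (fun y => if i ∈ u then (t i).indicator (1 : X i → ℝ≥0∞) y else 1) := by
        split_ifs
        exacts [measurable_one.indicator (ht i), measurable_const]
      by_cases hi : i ∈ s
      · rw [hs i hi, lintegral_withDensity_eq_lintegral_mul _ (hf i) hm]
        simp [g, hi]
      · rw [hs' i hi]
        simp [g, hi]
    rw [h1, h2]
    split_ifs
    · rw [lintegral_indicator_one (ht i)]
    · simp
  simp_rw [hint]
  rw [Finset.prod_ite_mem, Finset.union_inter_cancel_right]

theorem map_withDensity_comp {α β : Type*} [MeasurableSpace α] [MeasurableSpace β] (P : Measure α)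
    {φ : α → β} (hφ : Measurable φ) {f : β → ℝ≥0∞} (hf : Measurable f) :
    (P.withDensity (f ∘ φ)).map φ = (P.map φ).withDensity f := by
  ext s hs
  rw [Measure.map_apply hφ hs, withDensity_apply _ (hφ hs), withDensity_apply _ hs,
    setLIntegral_map hs hf hφ]
  rfl

theorem gaussianReal_eq_withDensity (h : ℝ) :
    gaussianReal h 1 =
      (gaussianReal 0 1).withDensity (fun x => ENNReal.ofReal (Real.exp (h * x - h ^ 2 / 2))) := by
  rw [gaussianReal_of_var_ne_zero _ one_ne_zero, gaussianReal_of_var_ne_zero _ one_ne_zero,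
    ← withDensity_mul _ (measurable_gaussianPDF _ _) (by fun_prop)]
  congr 1
  ext x
  rw [Pi.mul_apply, gaussianPDF, gaussianPDF, ← ENNReal.ofReal_mul (gaussianPDFReal_nonneg _ _ _),
    gaussianPDFReal, gaussianPDFReal, mul_assoc (√_)⁻¹, ← Real.exp_add]
  congr 3
  simp
  ring

/-- The Cameron–Martin formula for the standard Gaussian measure on Euclidean space. -/
theorem stdGaussian_map_add_const {ι : Type*} [Fintype ι] (h : EuclideanSpace ℝ ι) :
    (stdGaussian (EuclideanSpace ℝ ι)).map (fun x => x + h) =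
      (stdGaussian (EuclideanSpace ℝ ι)).withDensity
        (fun x => ENNReal.ofReal (Real.exp (⟪h, x⟫ - ‖h‖ ^ 2 / 2))) := by
  rw [← map_pi_eq_stdGaussian, ← map_withDensity_comp _ (by fun_prop) (by fun_prop),
    Measure.map_map (by fun_prop) (by fun_prop)]
  have e1 : (fun x => x + h) ∘ (WithLp.toLp 2 : (ι → ℝ) → EuclideanSpace ℝ ι) =
      WithLp.toLp 2 ∘ (fun x i => x i + h i) := by
    ext x i
    simp
  rw [e1, ← Measure.map_map (by fun_prop) (by fun_prop)]
  congr 1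
  have e2 : ((fun x => ENNReal.ofReal (Real.exp (⟪h, x⟫ - ‖h‖ ^ 2 / 2))) ∘
      (WithLp.toLp 2 : (ι → ℝ) → EuclideanSpace ℝ ι)) =
      fun x => ∏ i, ENNReal.ofReal (Real.exp (h i * x i - h i ^ 2 / 2)) := by
    ext x
    rw [← ENNReal.ofReal_prod_of_nonneg (fun _ _ => (Real.exp_pos _).le), ← Real.exp_sum]
    simp only [Function.comp_apply, EuclideanSpace.real_norm_sq_eq, PiLp.inner_apply]
    congr 2
    rw [Finset.sum_sub_distrib, Finset.sum_div]
    simp [mul_comm]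
  rw [e2, ← Measure.infinitePi_eq_pi,
    infinitePi_withDensity (fun _ : ι => gaussianReal 0 1) (fun i => gaussianReal (h i) 1)
      Finset.univ (fun i x => ENNReal.ofReal (Real.exp (h i * x - h i ^ 2 / 2)))
      (fun i => by fun_prop) (fun i _ => gaussianReal_eq_withDensity _) (by simp)]
  rw [Measure.infinitePi_map_pi (f := fun i x => x + h i) _ (fun i => by fun_prop)]
  congr 1
  ext i : 1
  rw [gaussianReal_map_add_const, zero_add]

/-- Two Gaussian measures with the same covariance matrix whose means differ by `S v`. -/
theorem multivariateGaussian_add_eq_withDensity {ι : Type*} [Fintype ι] [DecidableEq ι]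
    {S : Matrix ι ι ℝ} (hS : S.PosSemidef) (m v : EuclideanSpace ℝ ι) :
    multivariateGaussian (m + Matrix.toEuclideanCLM (𝕜 := ℝ) S v) S =
      (multivariateGaussian m S).withDensity (fun x => ENNReal.ofReal (Real.exp
        (⟪v, x - m⟫ - ⟪v, Matrix.toEuclideanCLM (𝕜 := ℝ) S v⟫ / 2))) := by
  set R := Matrix.toEuclideanCLM (𝕜 := ℝ) (CFC.sqrt S) with hR
  have hRR : ∀ x, R (R x) = Matrix.toEuclideanCLM (𝕜 := ℝ) S x := by
    intro x
    rw [hR, ← ContinuousLinearMap.comp_apply, ← ContinuousLinearMap.mul_def, ← map_mul,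
      CFC.sqrt_mul_sqrt_self _ hS.nonneg]
  have hsa : ∀ x y, ⟪R x, y⟫ = ⟪x, R y⟫ := by
    intro x y
    have : IsSelfAdjoint R := (CFC.sqrt_nonneg S).isSelfAdjoint.map _
    rw [← ContinuousLinearMap.adjoint_inner_left, this.adjoint_eq]
  rw [multivariateGaussian, multivariateGaussian, ← map_withDensity_comp _ (by fun_prop)
    (by fun_prop)]
  -- With `R` the square root of `S`, shifting the mean by `S v = R (R v)` is shifting the standard
  -- Gaussian by `R v` before applying `R`. No inverse of `S` is needed.
  have e1 : (fun x => m + Matrix.toEuclideanCLM (𝕜 := ℝ) S v + R x) =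
      (fun x => m + R x) ∘ (fun x => x + R v) := by
    ext1 x
    simp only [Function.comp_apply, map_add, hRR]
    abel
  have e2 : (fun x => ENNReal.ofReal (Real.exp
        (⟪v, x - m⟫ - ⟪v, Matrix.toEuclideanCLM (𝕜 := ℝ) S v⟫ / 2))) ∘ (fun x => m + R x) =
      fun x => ENNReal.ofReal (Real.exp (⟪R v, x⟫ - ‖R v‖ ^ 2 / 2)) := by
    ext1 x
    simp only [Function.comp_apply, add_sub_cancel_left]
    rw [hsa, ← real_inner_self_eq_norm_sq, hsa, hRR]
  rw [e1, e2, ← Measure.map_map (by fun_prop) (by fun_prop), stdGaussian_map_add_const]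

/-! ### The equicorrelated model and the swap of one signal -/

theorem equicorr_mulVec {K : ℕ} (ρ : ℝ) (x : Fin K → ℝ) (k : Fin K) :
    (equicorr K ρ).mulVec x k = (1 - ρ) * x k + ρ * ∑ l, x l := by
  have : ∀ l, equicorr K ρ k l * x l = (if k = l then (1 - ρ) * x l else 0) + ρ * x l := by
    intro l
    simp only [equicorr, Matrix.of_apply]
    split_ifs <;> ring
  simp [Matrix.mulVec, dotProduct, this, Finset.sum_add_distrib, Finset.mul_sum]

theorem equicorr_posSemidef (K : ℕ) {ρ : ℝ} (h0 : 0 ≤ ρ) (h1 : ρ ≤ 1) :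
    (equicorr K ρ).PosSemidef := by
  refine Matrix.PosSemidef.of_dotProduct_mulVec_nonneg ?_ fun x => ?_
  · ext i j
    simp [equicorr, Matrix.conjTranspose_apply, eq_comm]
  · have : star x ⬝ᵥ (equicorr K ρ).mulVec x = (1 - ρ) * ∑ k, x k ^ 2 + ρ * (∑ k, x k) ^ 2 := by
      simp only [dotProduct, equicorr_mulVec, Pi.star_apply, star_trivial, mul_add,
        Finset.sum_add_distrib]
      rw [sq (∑ k, x k), ← Finset.sum_mul, Finset.mul_sum Finset.univ (fun k => x k ^ 2)]
      congr 1
      · exact Finset.sum_congr rfl fun _ _ => by ring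
      · ring
    rw [this]
    have := sub_nonneg.2 h1
    positivity

/-- The signal set obtained from `A` by replacing the signal `i` by `j`. -/
def swapSignal {K : ℕ} (A : Finset (Fin K)) (i j : Fin K) : Finset (Fin K) :=
  insert j (A.erase i)

theorem card_swapSignal {K : ℕ} {A : Finset (Fin K)} {i j : Fin K} (hi : i ∈ A) (hj : j ∉ A) :
    (swapSignal A i j).card = A.card := by
  rw [swapSignal, Finset.card_insert_of_notMem (by simp [hj]), Finset.card_erase_of_mem hi]
  have := Finset.card_pos.2 ⟨i, hi⟩
  omega

/-- The coordinates of the contrast sum to zero, so the `ρ`-part of the matrix kills it and only the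
factor `1 - ρ` remains. This writes the shift of the mean in the form `S v` that the Gaussian
density formula requires. -/
theorem meanVec_swapSignal {K : ℕ} {A : Finset (Fin K)} {i j : Fin K} (μ : ℝ) {ρ : ℝ} (hρ : ρ ≠ 1)
    (hi : i ∈ A) (hj : j ∉ A) :
    meanVec μ (swapSignal A i j) = meanVec μ A + Matrix.toEuclideanCLM (𝕜 := ℝ) (equicorr K ρ)
      ((μ / (1 - ρ)) • (EuclideanSpace.single j 1 - EuclideanSpace.single i 1)) := by
  have hij : i ≠ j := fun h => hj (h ▸ hi)
  have hρ' : 1 - ρ ≠ 0 := sub_ne_zero.2 hρ.symm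
  ext k
  rw [PiLp.add_apply, Matrix.ofLp_toEuclideanCLM, equicorr_mulVec]
  simp only [meanVec, swapSignal, PiLp.smul_apply, PiLp.sub_apply, PiLp.single_apply,
    smul_eq_mul, ← Finset.mul_sum, Finset.sum_sub_distrib, Finset.sum_ite_eq', Finset.mem_univ,
    if_true, sub_self, mul_zero, add_zero, Finset.mem_insert, Finset.mem_erase]
  rw [← mul_assoc, mul_div_cancel₀ _ hρ']
  by_cases h1 : k = j
  · subst h1
    simp [hj, hij.symm]
  · by_cases h2 : k = i
    · subst h2
      simp [hi, hij]
    · simp [h1, h2]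

/-- The likelihood ratio of one observation when the signal `i` is replaced by `j`. -/
theorem multivariateGaussian_swapSignal {K : ℕ} {A : Finset (Fin K)} {i j : Fin K} (μ : ℝ) {ρ : ℝ}
    (h0 : 0 ≤ ρ) (h1 : ρ < 1) (hi : i ∈ A) (hj : j ∉ A) :
    multivariateGaussian (meanVec μ (swapSignal A i j)) (equicorr K ρ) =
      (multivariateGaussian (meanVec μ A) (equicorr K ρ)).withDensity
        (fun x => ENNReal.ofReal (Real.exp (μ / (1 - ρ) * (x j - x i)))) := by
  have hij : i ≠ j := fun h => hj (h ▸ hi)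
  have hρ' : 1 - ρ ≠ 0 := (sub_pos.2 h1).ne'
  set v : EuclideanSpace ℝ (Fin K) :=
    (μ / (1 - ρ)) • (EuclideanSpace.single j 1 - EuclideanSpace.single i 1) with hv
  have hm := meanVec_swapSignal (i := i) (j := j) (A := A) μ h1.ne hi hj
  have hinner : ∀ y : EuclideanSpace ℝ (Fin K), ⟪v, y⟫ = μ / (1 - ρ) * (y j - y i) := by
    intro y
    rw [hv, real_inner_smul_left, inner_sub_left, EuclideanSpace.inner_single_left,
      EuclideanSpace.inner_single_left]
    simp
  have hSv : Matrix.toEuclideanCLM (𝕜 := ℝ) (equicorr K ρ) v =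
      meanVec μ (swapSignal A i j) - meanVec μ A := by
    rw [hm, add_sub_cancel_left]
  rw [hm, multivariateGaussian_add_eq_withDensity (equicorr_posSemidef K h0 h1.le)]
  congr 1
  ext x
  -- The deterministic terms cancel: the midpoint of the two mean vectors equals `μ / 2` at both `i`
  -- and `j`.
  rw [hSv, hinner, hinner]
  congr 2
  simp [meanVec, swapSignal, hi, hj, hij, hij.symm]
  ring

/-! ### Change of measure on path space -/

instance isProbabilityMeasure_law {K : ℕ} (μ ρ : ℝ) (A : Finset (Fin K)) :
    IsProbabilityMeasure (law μ ρ A) := by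
  unfold law
  infer_instance

theorem infinitePi_apply_congr {ι : Type*} {X : ι → Type*} [∀ i, MeasurableSpace (X i)]
    (P Q : ∀ i, Measure (X i)) [∀ i, IsProbabilityMeasure (P i)] [∀ i, IsProbabilityMeasure (Q i)]
    (s : Finset ι) (h : ∀ i ∈ s, P i = Q i) {G : Set (∀ i, X i)}
    (hG : MeasurableSet[MeasurableSpace.comap s.restrict MeasurableSpace.pi] G) :
    Measure.infinitePi P G = Measure.infinitePi Q G := by
  obtain ⟨B, hB, rfl⟩ := hG
  rw [← Measure.map_apply (Finset.measurable_restrict s) hB,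
    ← Measure.map_apply (Finset.measurable_restrict s) hB, Measure.infinitePi_map_restrict,
    Measure.infinitePi_map_restrict]
  congr 2
  ext1 i
  exact h i i.2

theorem dataFiltration_le_comap_restrict (K n : ℕ) :
    dataFiltration K n ≤ MeasurableSpace.comap (Finset.range n).restrict MeasurableSpace.pi := by
  refine iSup₂_le fun j hj => ?_
  have : (fun ω : Path K => ω j) =
      (fun x : (∀ i : Finset.range n, EuclideanSpace ℝ (Fin K)) =>
        x ⟨j, Finset.mem_range.2 hj⟩) ∘ (Finset.range n).restrict := rfl
  rw [this, ← MeasurableSpace.comap_comp]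
  exact MeasurableSpace.comap_mono (measurable_pi_apply _).comap_le

theorem measurable_eval_dataFiltration {K j n : ℕ} (h : j < n) :
    Measurable[dataFiltration K n] (fun ω : Path K => ω j) := by
  have : MeasurableSpace.comap (fun ω : Path K => ω j) inferInstance ≤ dataFiltration K n :=
    le_iSup₂ (f := fun j (_ : j < n) =>
      MeasurableSpace.comap (fun ω : Path K => ω j) inferInstance) j h
  exact Measurable.mono (comap_measurable _) this le_rfl

theorem measurable_partialSum_dataFiltration {K k n : ℕ} (h : k ≤ n) (i : Fin K) :
    Measurable[dataFiltration K n] (fun ω : Path K => partialSum k ω i) := by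
  unfold partialSum
  refine Finset.measurable_sum (m := dataFiltration K n) _ fun j hj => ?_
  have h2 : Measurable (fun x : EuclideanSpace ℝ (Fin K) => x i) := by fun_prop
  exact h2.comp (measurable_eval_dataFiltration ((Finset.mem_range.1 hj).trans_le h))

/-- Change of measure for events determined by the first `n` observations. -/
theorem law_swapSignal_apply {K : ℕ} {A : Finset (Fin K)} {i j : Fin K} (μ : ℝ) {ρ : ℝ}
    (h0 : 0 ≤ ρ) (h1 : ρ < 1) (hi : i ∈ A) (hj : j ∉ A) {n : ℕ} {G : Set (Path K)}
    (hG : MeasurableSet[dataFiltration K n] G) :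
    law μ ρ (swapSignal A i j) G = ∫⁻ ω in G, ENNReal.ofReal
      (Real.exp (μ / (1 - ρ) * (partialSum n ω j - partialSum n ω i))) ∂(law μ ρ A) := by
  set g := multivariateGaussian (meanVec μ A) (equicorr K ρ)
  set g' := multivariateGaussian (meanVec μ (swapSignal A i j)) (equicorr K ρ)
  set f : EuclideanSpace ℝ (Fin K) → ℝ≥0∞ :=
    fun x => ENNReal.ofReal (Real.exp (μ / (1 - ρ) * (x j - x i))) with hf
  have : ∀ k, IsProbabilityMeasure (if k < n then g' else g) := by
    intro k
    split_ifs <;> infer_instance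
  -- On whole paths there is in general no density, so only the first `n` factors are changed. The
  -- resulting hybrid law agrees with the swapped law on events of the first `n` observations.
  have hd := infinitePi_withDensity (fun _ : ℕ => g) (fun k => if k < n then g' else g)
    (Finset.range n) (fun _ => f) (fun _ => by fun_prop)
    (fun k hk => by
      rw [if_pos (Finset.mem_range.1 hk)]
      exact multivariateGaussian_swapSignal μ h0 h1 hi hj)
    (fun k hk => by rw [if_neg (by simpa using hk)])
  have e : (fun x : Path K => ∏ k ∈ Finset.range n, f (x k)) = fun ω => ENNReal.ofReal
      (Real.exp (μ / (1 - ρ) * (partialSum n ω j - partialSum n ω i))) := by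
    ext1 ω
    rw [hf, ← ENNReal.ofReal_prod_of_nonneg (fun _ _ => (Real.exp_pos _).le), ← Real.exp_sum,
      ← Finset.mul_sum, Finset.sum_sub_distrib]
    rfl
  have hG' := (dataFiltration K).le n _ hG
  rw [e] at hd
  rw [← withDensity_apply _ hG']
  change _ = (Measure.infinitePi fun _ : ℕ => g).withDensity _ G
  rw [hd]
  exact infinitePi_apply_congr (fun _ : ℕ => g') (fun k => if k < n then g' else g)
    (Finset.range n) (fun k hk => by rw [if_pos (Finset.mem_range.1 hk)])
    (dataFiltration_le_comap_restrict K n _ hG)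

/-- The difference of the partial sums of the streams `j` and `i` at the random time `T`
(and `0` where `T` is infinite). -/
noncomputable def stoppedDiff {K : ℕ} (T : Path K → WithTop ℕ) (j i : Fin K) (ω : Path K) : ℝ :=
  partialSum ((T ω).untopD 0) ω j - partialSum ((T ω).untopD 0) ω i

theorem stoppedDiff_swap {K : ℕ} (T : Path K → WithTop ℕ) (j i : Fin K) (ω : Path K) :
    stoppedDiff T j i ω = -stoppedDiff T i j ω := by
  simp [stoppedDiff]

theorem inter_ne_top_eq_iUnion {Ω : Type*} (G : Set Ω) (T : Ω → WithTop ℕ) :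
    G ∩ {ω | T ω ≠ ⊤} = ⋃ n : ℕ, G ∩ {ω | T ω = WithTop.some n} := by
  ext ω
  simp only [Set.mem_inter_iff, Set.mem_ofPred_eq, Set.mem_iUnion, exists_and_left,
    WithTop.ne_top_iff_exists, eq_comm]

theorem pairwise_disjoint_inter_eq {Ω : Type*} (G : Set Ω) (T : Ω → WithTop ℕ) :
    Pairwise (Function.onFun Disjoint fun n : ℕ => G ∩ {ω | T ω = WithTop.some n}) := by
  intro a b hab
  refine Set.disjoint_left.2 fun ω ha hb => hab ?_
  exact WithTop.coe_injective (ha.2.symm.trans hb.2)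

/-- Change of measure at a stopping time, on the event that it is finite. -/
theorem law_swapSignal_stopped {K : ℕ} {A : Finset (Fin K)} {i j : Fin K} (μ : ℝ) {ρ : ℝ}
    (h0 : 0 ≤ ρ) (h1 : ρ < 1) (hi : i ∈ A) (hj : j ∉ A) {T : Path K → WithTop ℕ}
    {G : Set (Path K)} (hG : ∀ n : ℕ, MeasurableSet[dataFiltration K n] (G ∩ {ω | T ω = WithTop.some n})) :
    law μ ρ (swapSignal A i j) (G ∩ {ω | T ω ≠ ⊤}) = ∫⁻ ω in G ∩ {ω | T ω ≠ ⊤}, ENNReal.ofReal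
      (Real.exp (μ / (1 - ρ) * stoppedDiff T j i ω)) ∂(law μ ρ A) := by
  have hG' : ∀ n : ℕ, MeasurableSet (G ∩ {ω | T ω = WithTop.some n}) := fun n => (dataFiltration K).le n _ (hG n)
  -- On each piece `T = n` the event is determined by `n` observations, so the change of measure at
  -- fixed `n` applies there.
  rw [inter_ne_top_eq_iUnion, measure_iUnion (pairwise_disjoint_inter_eq G T) hG',
    lintegral_iUnion hG' (pairwise_disjoint_inter_eq G T)]
  congr 1
  ext1 n
  rw [law_swapSignal_apply μ h0 h1 hi hj (hG n)]
  refine setLIntegral_congr_fun (hG' n) fun ω hω => ?_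
  have : T ω = WithTop.some n := hω.2
  simp only [stoppedDiff, this, WithTop.untopD_coe]

/-! ### Order statistics and the gap rule as a sequential test -/

/-- Sorting breaks ties by index, so a given ranking is described by finitely many comparisons of
coordinates. As there are finitely many rankings, measurability of order statistics and top sets
follows piecewise. -/
theorem measurableSet_ranking_eq {K : ℕ} (σ : Equiv.Perm (Fin K)) :
    MeasurableSet {s : Fin K → ℝ | ranking s = σ} := by
  have : {s : Fin K → ℝ | ranking s = σ} =
      (⋂ a, ⋂ b, ⋂ (_ : a ≤ b), {s : Fin K → ℝ | s (σ b) ≤ s (σ a)}) ∩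
      ⋂ a, ⋂ b, ⋂ (_ : a < b), ({s : Fin K → ℝ | s (σ a) = s (σ b)}ᶜ ∪ {_s | σ a < σ b}) := by
    ext s
    simp only [Set.mem_ofPred_eq, ranking, eq_comm (b := σ), Tuple.eq_sort_iff, Monotone,
      Function.comp_apply, neg_le_neg_iff, neg_inj, Set.mem_inter_iff, Set.mem_iInter,
      Set.mem_union, Set.mem_compl_iff, imp_iff_not_or]
  rw [this]
  refine MeasurableSet.inter ?_ ?_
  · exact MeasurableSet.iInter fun a => MeasurableSet.iInter fun b => MeasurableSet.iInter fun _ =>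
      measurableSet_le (measurable_pi_apply _) (measurable_pi_apply _)
  · exact MeasurableSet.iInter fun a => MeasurableSet.iInter fun b => MeasurableSet.iInter fun _ =>
      ((measurableSet_eq_fun (measurable_pi_apply (σ a)) (measurable_pi_apply (σ b))).compl).union
        (MeasurableSet.const _)

theorem measurable_orderStat {K : ℕ} (k : ℕ) :
    Measurable (fun s : Fin K → ℝ => orderStat s k) := by
  by_cases h : 1 ≤ k ∧ k ≤ K
  · intro B hB
    have : (fun s : Fin K → ℝ => orderStat s k) ⁻¹' B =
        ⋃ σ : Equiv.Perm (Fin K), {s | ranking s = σ} ∩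
          (fun s : Fin K → ℝ => s (σ ⟨k - 1, by omega⟩)) ⁻¹' B := by
      ext s
      simp [orderStat, h]
    rw [this]
    exact MeasurableSet.iUnion fun σ =>
      (measurableSet_ranking_eq σ).inter (measurable_pi_apply _ hB)
  · simp [orderStat, h]

theorem measurableSet_mem_topStreams {K : ℕ} (m : ℕ) (i : Fin K) :
    MeasurableSet {s : Fin K → ℝ | i ∈ topStreams m s} := by
  have : {s : Fin K → ℝ | i ∈ topStreams m s} =
      ⋃ σ : Equiv.Perm (Fin K), {s | ranking s = σ} ∩ {_s | (σ.symm i : ℕ) < m} := by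
    ext s
    simp [topStreams]
  rw [this]
  exact MeasurableSet.iUnion fun σ => (measurableSet_ranking_eq σ).inter (MeasurableSet.const _)

theorem apply_ranking_antitone {K : ℕ} (s : Fin K → ℝ) {a b : Fin K} (h : a ≤ b) :
    s (ranking s b) ≤ s (ranking s a) :=
  neg_le_neg_iff.1 (Tuple.monotone_sort (fun i => -s i) h)

theorem card_topStreams {K m : ℕ} (h : m ≤ K) (s : Fin K → ℝ) : (topStreams m s).card = m := by
  have : topStreams m s =
      (Finset.univ.filter fun a : Fin K => (a : ℕ) < m).map (ranking s).toEmbedding := by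
    ext i
    simp only [topStreams, Finset.mem_filter, Finset.mem_univ, true_and, Finset.mem_map_equiv]
  rw [this, Finset.card_map, Fin.card_filter_val_lt, min_eq_right h]

/-- The gap between the order statistics `s_(m)` and `s_(m+1)` is at most the difference of any
statistic of the top `m` and any of the others. -/
theorem orderStat_gap_le {K m : ℕ} (h1 : 1 ≤ m) (h2 : m < K) (s : Fin K → ℝ) {j i : Fin K}
    (hj : j ∈ topStreams m s) (hi : i ∉ topStreams m s) :
    orderStat s m - orderStat s (m + 1) ≤ s j - s i := by
  simp only [topStreams, Finset.mem_filter, Finset.mem_univ, true_and, not_lt] at hi hj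
  rw [orderStat, dif_pos ⟨h1, h2.le⟩, orderStat, dif_pos ⟨by omega, by omega⟩]
  have a1 : s (ranking s ⟨m - 1, by omega⟩) ≤ s j := by
    have := apply_ranking_antitone s (a := (ranking s).symm j) (b := ⟨m - 1, by omega⟩)
      (Fin.le_def.2 (by simp only; omega))
    simpa using this
  have a2 : s i ≤ s (ranking s ⟨m + 1 - 1, by omega⟩) := by
    have := apply_ranking_antitone s (b := (ranking s).symm i) (a := ⟨m + 1 - 1, by omega⟩)
      (Fin.le_def.2 (by simp only; omega))
    simpa using this
  linarith

/-- If the statistics of the streams in `A` exceed all the others by at least `b > 0`, then so does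
the gap between the order statistics. -/
theorem le_orderStat_gap {K m : ℕ} (h1 : 1 ≤ m) (h2 : m < K) {A : Finset (Fin K)} (hA : A.card = m)
    (s : Fin K → ℝ) {b : ℝ} (hb : 0 < b) (hs : ∀ i ∈ A, ∀ j ∉ A, b ≤ s i - s j) :
    b ≤ orderStat s m - orderStat s (m + 1) := by
  have hle : ∀ j ∈ topStreams m s, ∀ i ∉ topStreams m s, s i ≤ s j := by
    intro j hj i hi
    simp only [topStreams, Finset.mem_filter, Finset.mem_univ, true_and, not_lt] at hi hj
    have := apply_ranking_antitone s (a := (ranking s).symm j) (b := (ranking s).symm i)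
      (Fin.le_def.2 (by omega))
    simpa using this
  have htop : topStreams m s = A := by
    by_contra hne
    have hcard := card_topStreams h2.le s
    obtain ⟨j, hj, hjA⟩ := Finset.not_subset.1 fun hsub =>
      hne (Finset.eq_of_subset_of_card_le hsub (by omega))
    obtain ⟨i, hi, hiT⟩ := Finset.not_subset.1 fun hsub =>
      hne (Finset.eq_of_subset_of_card_le hsub (by omega)).symm
    have := hle j hj i hiT
    have := hs i hi j hjA
    linarith
  rw [orderStat, dif_pos ⟨h1, h2.le⟩, orderStat, dif_pos ⟨by omega, by omega⟩]
  refine hs _ ?_ _ ?_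
  · refine htop.subset ?_
    simp only [topStreams, Finset.mem_filter, Finset.mem_univ, true_and, Equiv.symm_apply_apply]
    omega
  · refine fun h => absurd (htop.symm.subset h) ?_
    simp [topStreams]

theorem measurable_partialSum_pi {K n k : ℕ} (h : k ≤ n) :
    Measurable[dataFiltration K n] (fun ω : Path K => partialSum k ω) := by
  let _ := dataFiltration K n
  exact measurable_pi_iff.2 fun i => measurable_partialSum_dataFiltration h i

theorem isStoppingTime_gapTime (K m : ℕ) (μ ρ c : ℝ) :
    IsStoppingTime (dataFiltration K) (gapTime K m μ ρ c) := by
  intro n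
  have : {ω | gapTime K m μ ρ c ω ≤ WithTop.some n} = ⋃ k ∈ Set.Icc 1 n,
      {ω | orderStat (partialSum k ω) m - orderStat (partialSum k ω) (m + 1) ∈
        Set.Ici ((1 - ρ) / μ * c)} := by
    ext ω
    simp only [Set.mem_ofPred_eq, gapTime, hittingAfter_le_iff, Set.mem_iUnion, exists_prop]
  rw [this]
  refine MeasurableSet.biUnion (Set.to_countable _) fun k hk => ?_
  exact ((measurable_orderStat m).sub (measurable_orderStat (m + 1))).comp
    (measurable_partialSum_pi hk.2) measurableSet_Ici

theorem gapRule_D_eq {K m : ℕ} {μ ρ c : ℝ} {ω : Path K} {n : ℕ}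
    (h : gapTime K m μ ρ c ω = WithTop.some n) :
    (gapRule K m μ ρ c).D ω = topStreams m (partialSum n ω) := by
  change topStreams m (partialSum ((gapTime K m μ ρ c ω).untopD 0) ω) = _
  rw [h]
  rfl

theorem measurableSet_le_iSup_dataFiltration {K n : ℕ} {G : Set (Path K)}
    (hG : MeasurableSet[dataFiltration K n] G) : MeasurableSet[⨆ t, dataFiltration K t] G :=
  le_iSup (fun t => dataFiltration K t) n _ hG

theorem isSequentialTest_gapRule (K m : ℕ) (μ ρ c : ℝ) :
    IsSequentialTest (gapRule K m μ ρ c) := by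
  refine ⟨fun ω => ?_, isStoppingTime_gapTime K m μ ρ c, fun i => ?_⟩
  · change WithTop.some 1 ≤ gapTime K m μ ρ c ω
    exact le_hittingAfter ω
  have hT := isStoppingTime_gapTime K m μ ρ c
  have hn : ∀ n : ℕ, MeasurableSet[dataFiltration K n]
      ({ω | i ∈ (gapRule K m μ ρ c).D ω} ∩ {ω | gapTime K m μ ρ c ω = WithTop.some n}) := by
    intro n
    have : {ω | i ∈ (gapRule K m μ ρ c).D ω} ∩ {ω | gapTime K m μ ρ c ω = WithTop.some n} =
        {ω | i ∈ topStreams m (partialSum n ω)} ∩ {ω | gapTime K m μ ρ c ω = WithTop.some n} := by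
      ext ω
      refine and_congr_left fun h => ?_
      rw [Set.mem_ofPred_eq, Set.mem_ofPred_eq, gapRule_D_eq h]
    rw [this]
    exact (measurable_partialSum_pi le_rfl (measurableSet_mem_topStreams m i)).inter
      (hT.measurableSet_eq n)
  refine (hT.measurableSet _).2 ⟨?_, fun n => ?_⟩
  · have htop : MeasurableSet[⨆ t, dataFiltration K t] {ω | gapTime K m μ ρ c ω ≠ ⊤} := by
      have := inter_ne_top_eq_iUnion Set.univ (gapTime K m μ ρ c)
      simp only [Set.univ_inter] at this
      rw [this]
      exact MeasurableSet.iUnion fun n => measurableSet_le_iSup_dataFiltration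
        (hT.measurableSet_eq n)
    -- Where the rule never stops, the default time `0` makes all partial sums zero, so the decision
    -- there is a constant.
    have : {ω | i ∈ (gapRule K m μ ρ c).D ω} =
        ({ω | i ∈ (gapRule K m μ ρ c).D ω} ∩ {ω | gapTime K m μ ρ c ω ≠ ⊤}) ∪
          ({ω | gapTime K m μ ρ c ω ≠ ⊤}ᶜ ∩ {_ω | i ∈ topStreams (K := K) m 0}) := by
      ext ω
      by_cases h : gapTime K m μ ρ c ω = ⊤
      · have : partialSum 0 ω = 0 := by
          ext
          simp [partialSum]
        simp [h, gapRule, this]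
      · simp [h]
    rw [this, inter_ne_top_eq_iUnion]
    exact (MeasurableSet.iUnion fun n => measurableSet_le_iSup_dataFiltration (hn n)).union
      (htop.compl.inter (MeasurableSet.const _))
  · have : {ω | i ∈ (gapRule K m μ ρ c).D ω} ∩ {ω | gapTime K m μ ρ c ω ≤ WithTop.some n} =
        ⋃ k ∈ Set.Iic n, {ω | i ∈ (gapRule K m μ ρ c).D ω} ∩
          {ω | gapTime K m μ ρ c ω = WithTop.some k} := by
      ext ω
      simp only [Set.mem_inter_iff, Set.mem_ofPred_eq, Set.mem_iUnion, Set.mem_Iic, exists_prop]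
      constructor
      · rintro ⟨h, hle⟩
        obtain ⟨k, hk⟩ := WithTop.ne_top_iff_exists.1 (ne_top_of_le_ne_top WithTop.coe_ne_top hle)
        exact ⟨k, WithTop.coe_le_coe.1 (hk ▸ hle), h, hk.symm⟩
      · rintro ⟨k, hk, h, he⟩
        exact ⟨h, he ▸ WithTop.coe_le_coe.2 hk⟩
    change MeasurableSet[dataFiltration K n]
      ({ω | i ∈ (gapRule K m μ ρ c).D ω} ∩ {ω | gapTime K m μ ρ c ω ≤ WithTop.some n})
    rw [this]
    exact MeasurableSet.biUnion (Set.to_countable _) fun k hk => (dataFiltration K).mono hk _ (hn k)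

theorem gap_le_stoppedDiff {K m : ℕ} {μ ρ c : ℝ} (h1 : 1 ≤ m) (h2 : m < K) {ω : Path K}
    (h : gapTime K m μ ρ c ω ≠ ⊤) {j i : Fin K} (hj : j ∈ (gapRule K m μ ρ c).D ω)
    (hi : i ∉ (gapRule K m μ ρ c).D ω) :
    (1 - ρ) / μ * c ≤ stoppedDiff (gapTime K m μ ρ c) j i ω := by
  obtain ⟨n, hn⟩ := WithTop.ne_top_iff_exists.1 h
  have hmem : (1 - ρ) / μ * c ≤ orderStat (partialSum (gapTime K m μ ρ c ω).untopA ω) m -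
      orderStat (partialSum (gapTime K m μ ρ c ω).untopA ω) (m + 1) :=
    hittingAfter_mem_set_of_ne_top (u := fun n ω =>
      orderStat (partialSum (K := K) n ω) m - orderStat (partialSum n ω) (m + 1)) h
  rw [gapRule_D_eq hn.symm] at hi hj
  rw [stoppedDiff]
  rw [← hn] at hmem ⊢
  exact hmem.trans (orderStat_gap_le h1 h2 _ hj hi)

/-- If every signal led every noise stream by the threshold, the top `m` streams would be exactly
`A` (this uses that the threshold is positive) and the rule would have stopped. -/
theorem gapTime_gt_imp {K m : ℕ} {μ ρ c : ℝ} (h1 : 1 ≤ m) (h2 : m < K) {A : Finset (Fin K)}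
    (hA : A.card = m) (hb : 0 < (1 - ρ) / μ * c) {ω : Path K} {n : ℕ} (hn : 1 ≤ n)
    (h : WithTop.some n < gapTime K m μ ρ c ω) :
    ∃ i ∈ A, ∃ j ∉ A, partialSum n ω i - partialSum n ω j < (1 - ρ) / μ * c := by
  by_contra! hcon
  exact notMem_of_lt_hittingAfter h hn (le_orderStat_gap h1 h2 hA _ hb hcon)

/-! ### Signal-minus-noise sums and the expected time of the gap rule -/

theorem map_sub_multivariateGaussian {K : ℕ} {A : Finset (Fin K)} {i j : Fin K} (μ : ℝ) {ρ : ℝ}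
    (h0 : 0 ≤ ρ) (h1 : ρ < 1) (hi : i ∈ A) (hj : j ∉ A) :
    (multivariateGaussian (meanVec μ A) (equicorr K ρ)).map (fun x => x i - x j) =
      gaussianReal μ (2 * (1 - ρ)).toNNReal := by
  have hij : i ≠ j := fun h => hj (h ▸ hi)
  set v : EuclideanSpace ℝ (Fin K) := EuclideanSpace.single i 1 - EuclideanSpace.single j 1 with hv
  have hL : ∀ x : EuclideanSpace ℝ (Fin K), innerSL ℝ v x = x i - x j := by
    intro x
    rw [innerSL_apply_apply, hv, inner_sub_left, EuclideanSpace.inner_single_left,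
      EuclideanSpace.inner_single_left]
    simp
  have hfun : (fun x : EuclideanSpace ℝ (Fin K) => x i - x j) = innerSL ℝ v := by
    ext1 x
    rw [hL]
  have hS := equicorr_posSemidef K h0 h1.le
  rw [hfun, IsGaussian.map_eq_gaussianReal]
  congr 1
  · rw [ContinuousLinearMap.integral_comp_id_comm IsGaussian.integrable_id]
    rw [show (multivariateGaussian (meanVec μ A) (equicorr K ρ))[fun x => x] = meanVec μ A from
      integral_id_multivariateGaussian, hL]
    simp [meanVec, hi, hj]
  · congr 1
    have := covarianceBilin_self (μ := multivariateGaussian (meanVec μ A) (equicorr K ρ))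
      IsGaussian.memLp_two_id v
    rw [covarianceBilin_multivariateGaussian hS] at this
    change Var[fun x => inner ℝ v x; _] = _
    rw [← this]
    simp only [dotProduct, equicorr_mulVec]
    -- The common correlation drops out of the variance because the contrast sums to zero.
    have hs : ∑ l, v l = 0 := by simp [hv, PiLp.single_apply]
    simp only [hs, mul_zero, add_zero]
    have : ∀ k, v k * ((1 - ρ) * v k) =
        (if k = i then (1 - ρ) else 0) + (if k = j then (1 - ρ) else 0) := by
      intro k
      simp only [hv, PiLp.sub_apply, PiLp.single_apply]
      by_cases hki : k = i
      · subst hki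
        simp [hij]
      · by_cases hkj : k = j
        · subst hkj
          simp [hki]
        · simp [hki, hkj]
    simp only [this, Finset.sum_add_distrib, Finset.sum_ite_eq', Finset.mem_univ, if_true]
    ring

theorem measurePreserving_eval_law {K : ℕ} (μ ρ : ℝ) (A : Finset (Fin K)) (n : ℕ) :
    MeasurePreserving (fun ω : Path K => ω n) (law μ ρ A)
      (multivariateGaussian (meanVec μ A) (equicorr K ρ)) :=
  measurePreserving_eval_infinitePi
    (fun _ : ℕ => multivariateGaussian (meanVec μ A) (equicorr K ρ)) n

theorem map_sub_law {K : ℕ} {A : Finset (Fin K)} {i j : Fin K} (μ : ℝ) {ρ : ℝ}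
    (h0 : 0 ≤ ρ) (h1 : ρ < 1) (hi : i ∈ A) (hj : j ∉ A) (n : ℕ) :
    (law μ ρ A).map (fun ω => ω n i - ω n j) = gaussianReal μ (2 * (1 - ρ)).toNNReal := by
  rw [← map_sub_multivariateGaussian μ h0 h1 hi hj, ← (measurePreserving_eval_law μ ρ A n).map_eq,
    Measure.map_map (by fun_prop) (by fun_prop)]
  rfl

theorem indep_dataFiltration_eval {K : ℕ} (μ ρ : ℝ) (A : Finset (Fin K)) (n : ℕ) :
    Indep (dataFiltration K n)
      (MeasurableSpace.comap (fun ω : Path K => ω n) inferInstance) (law μ ρ A) := by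
  have h := iIndepFun_infinitePi
    (P := fun _ : ℕ => multivariateGaussian (meanVec μ A) (equicorr K ρ))
    (X := fun _ x => x) (fun _ => measurable_id)
  have h2 := indep_iSup_of_disjoint (μ := law μ ρ A)
    (m := fun k : ℕ => MeasurableSpace.comap (fun ω : Path K => ω k) inferInstance)
    (fun k => (measurable_pi_apply k).comap_le) h (S := Set.Iio n) (T := {n}) (by simp)
  rw [iSup_singleton] at h2
  exact h2

/-- Chernoff's bound: the centred increments are Gaussian of variance `2 (1 - ρ)`, and a deviation
of `n δ` costs `(n δ) ^ 2 / (2 n * 2 (1 - ρ))` in the exponent. -/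
theorem law_partialSum_le {K : ℕ} {A : Finset (Fin K)} {i j : Fin K} {μ ρ δ : ℝ}
    (h0 : 0 ≤ ρ) (h1 : ρ < 1) (hi : i ∈ A) (hj : j ∉ A) (hδ : 0 ≤ δ) (n : ℕ) :
    (law μ ρ A).real {ω | partialSum n ω i - partialSum n ω j ≤ n * (μ - δ)} ≤
      Real.exp (-(δ ^ 2 / (4 * (1 - ρ)))) ^ n := by
  have hsub : 0 < 1 - ρ := sub_pos.2 h1
  have hind : iIndepFun (fun (k : ℕ) (ω : Path K) => μ - (ω k i - ω k j)) (law μ ρ A) :=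
    iIndepFun_infinitePi (P := fun _ : ℕ => multivariateGaussian (meanVec μ A) (equicorr K ρ))
      (X := fun _ x => μ - (x i - x j)) (fun _ => by fun_prop)
  have hlaw : ∀ k : ℕ, (law μ ρ A).map (fun ω => μ - (ω k i - ω k j)) =
      gaussianReal 0 (2 * (1 - ρ)).toNNReal := by
    intro k
    have : (fun ω : Path K => μ - (ω k i - ω k j)) = (fun y => μ - y) ∘ fun ω => ω k i - ω k j :=
      rfl
    rw [this, ← Measure.map_map (by fun_prop) (by fun_prop), map_sub_law μ h0 h1 hi hj,
      gaussianReal_map_const_sub, sub_self]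
  have hsg : ∀ k < n, HasSubgaussianMGF (fun ω : Path K => μ - (ω k i - ω k j))
      (2 * (1 - ρ)).toNNReal (law μ ρ A) := by
    intro k _
    refine ⟨fun t => ?_, fun t => ?_⟩
    · have := integrable_exp_mul_gaussianReal (μ := 0) (v := (2 * (1 - ρ)).toNNReal) t
      rw [← hlaw k] at this
      exact this.comp_measurable (by fun_prop)
    · rw [mgf_gaussianReal (hlaw k)]
      simp
  have hmain := HasSubgaussianMGF.measure_sum_range_ge_le_of_iIndepFun hind (n := n) hsg
    (ε := n * δ) (by positivity)
  have hset : {ω : Path K | partialSum n ω i - partialSum n ω j ≤ n * (μ - δ)} =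
      {ω | n * δ ≤ ∑ k ∈ Finset.range n, (μ - (ω k i - ω k j))} := by
    ext ω
    simp only [Set.mem_ofPred_eq, partialSum, Finset.sum_sub_distrib, Finset.sum_const,
      Finset.card_range, nsmul_eq_mul]
    constructor <;> intro h <;> linarith
  rw [hset]
  refine hmain.trans_eq ?_
  rw [← Real.exp_nat_mul]
  congr 1
  rcases eq_or_ne n 0 with rfl | hn
  · simp
  · have : (n : ℝ) ≠ 0 := Nat.cast_ne_zero.2 hn
    rw [Real.coe_toNNReal _ (by positivity)]
    field_simp
    norm_num

theorem toENNReal_eq_tsum (t : WithTop ℕ) :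
    ENat.toENNReal t = ∑' n : ℕ, if WithTop.some n < t then (1 : ℝ≥0∞) else 0 := by
  cases t with
  | top =>
    simp
    rfl
  | coe N =>
    rw [tsum_eq_sum (s := Finset.range N) (fun n hn => by
      rw [if_neg]
      simpa using hn)]
    rw [Finset.sum_congr rfl (g := fun _ => (1 : ℝ≥0∞)) (fun n hn => by
      rw [if_pos]
      exact WithTop.coe_lt_coe.2 (Finset.mem_range.1 hn))]
    simp only [Finset.sum_const, Finset.card_range, nsmul_eq_mul, mul_one]
    rfl

theorem measurableSet_lt_stoppingTime {K : ℕ} {T : Path K → WithTop ℕ}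
    (hT : IsStoppingTime (dataFiltration K) T) (n : ℕ) :
    MeasurableSet {ω | WithTop.some n < T ω} :=
  (dataFiltration K).le n _ (hT.measurableSet_gt n)

theorem lintegral_stoppingTime {K : ℕ} {T : Path K → WithTop ℕ} (P : Measure (Path K))
    (hT : IsStoppingTime (dataFiltration K) T) :
    ∫⁻ ω, ENat.toENNReal (T ω) ∂P = ∑' n : ℕ, P {ω | WithTop.some n < T ω} := by
  simp_rw [toENNReal_eq_tsum]
  rw [lintegral_tsum fun n => (Measurable.ite (measurableSet_lt_stoppingTime hT n)
    measurable_const measurable_const).aemeasurable]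
  congr 1
  ext1 n
  rw [← lintegral_indicator_one (measurableSet_lt_stoppingTime hT n)]
  simp [Set.indicator_apply]

theorem measurable_toENNReal_stoppingTime {K : ℕ} {T : Path K → WithTop ℕ}
    (hT : IsStoppingTime (dataFiltration K) T) :
    Measurable fun ω => ENat.toENNReal (T ω) := by
  simp_rw [toENNReal_eq_tsum]
  exact Measurable.tsum fun n => Measurable.ite (measurableSet_lt_stoppingTime hT n)
    measurable_const measurable_const

theorem ae_ne_top_of_lintegral_ne_top {K : ℕ} {T : Path K → WithTop ℕ} {P : Measure (Path K)}
    (hT : IsStoppingTime (dataFiltration K) T) (h : ∫⁻ ω, ENat.toENNReal (T ω) ∂P ≠ ⊤) :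
    ∀ᵐ ω ∂P, T ω ≠ ⊤ := by
  filter_upwards [ae_lt_top (measurable_toENNReal_stoppingTime hT) h] with ω hω
  exact (ENat.toENNReal_lt_top.1 hω).ne

/-- The expected sample size of the gap rule. -/
theorem expectedSampleSize_gapRule_le {K m : ℕ} (hm : 1 ≤ m) (hmK : m < K) {μ ρ δ : ℝ}
    (hρ0 : 0 ≤ ρ) (hρ1 : ρ < 1) (hδ : 0 < δ) (hδμ : δ < μ) {A : Finset (Fin K)}
    (hA : A.card = m) :
    ∃ C : ℝ, 0 ≤ C ∧ ∀ c : ℝ, 0 < c → expectedSampleSize μ ρ A (gapRule K m μ ρ c) ≤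
      ENNReal.ofReal ((1 - ρ) / μ * c / (μ - δ) + C) := by
  have hsub : 0 < 1 - ρ := sub_pos.2 hρ1
  have hμ : 0 < μ := hδ.trans hδμ
  have hμδ : 0 < μ - δ := sub_pos.2 hδμ
  set r : ℝ := Real.exp (-(δ ^ 2 / (4 * (1 - ρ)))) with hr
  have hr0 : 0 < r := Real.exp_pos _
  have hr1 : r < 1 := Real.exp_lt_one_iff.2 (by rw [neg_lt_zero]; positivity)
  set M : ℝ := (A.card : ℝ) * (Aᶜ.card : ℝ) with hM
  have hM0 : 0 ≤ M := by positivity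
  -- The `2` pays for the ceiling and the extra step in `N`; the rest sums the geometric tails over
  -- all signal-noise pairs.
  refine ⟨2 + M * (1 - r)⁻¹, by have := sub_pos.2 hr1; positivity, fun c hc => ?_⟩
  set b := (1 - ρ) / μ * c with hb
  have hb0 : 0 < b := by positivity
  -- Beyond `b / (μ - δ)` the drift reduced by `δ` has passed the threshold; the extra `1` ensures
  -- `n ≥ 1`, when stopping is allowed.
  set N : ℕ := ⌈b / (μ - δ)⌉₊ + 1 with hN
  have hT := isStoppingTime_gapTime K m μ ρ c
  have htail : ∀ n : ℕ, law μ ρ A {ω | WithTop.some n < gapTime K m μ ρ c ω} ≤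
      (if n < N then 1 else 0) + ENNReal.ofReal (M * r ^ n) := by
    intro n
    split_ifs with hnN
    · exact prob_le_one.trans le_self_add
    rw [zero_add]
    have hn1 : 1 ≤ n := by omega
    have hbn : b ≤ n * (μ - δ) := by
      have h1 : b / (μ - δ) ≤ n := (Nat.le_ceil _).trans (by exact_mod_cast (by omega))
      rwa [div_le_iff₀ hμδ] at h1
    have hsubset : {ω | WithTop.some n < gapTime K m μ ρ c ω} ⊆ ⋃ q ∈ A ×ˢ Aᶜ,
        {ω | partialSum n ω q.1 - partialSum n ω q.2 ≤ n * (μ - δ)} := by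
      intro ω hω
      obtain ⟨i, hi, j, hj, hlt⟩ := gapTime_gt_imp hm hmK hA hb0 hn1 hω
      simp only [Set.mem_iUnion, exists_prop]
      exact ⟨(i, j), by simp [hi, hj], (hlt.le.trans hbn)⟩
    calc law μ ρ A {ω | WithTop.some n < gapTime K m μ ρ c ω}
        ≤ ∑ q ∈ A ×ˢ Aᶜ, law μ ρ A
            {ω | partialSum n ω q.1 - partialSum n ω q.2 ≤ n * (μ - δ)} :=
          (measure_mono hsubset).trans (measure_biUnion_finset_le _ _)
      _ ≤ ∑ q ∈ A ×ˢ Aᶜ, ENNReal.ofReal (r ^ n) := by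
          refine Finset.sum_le_sum fun q hq => ?_
          simp only [Finset.mem_product, Finset.mem_compl] at hq
          rw [← ofReal_measureReal]
          exact ENNReal.ofReal_le_ofReal (law_partialSum_le hρ0 hρ1 hq.1 hq.2 hδ.le n)
      _ = ENNReal.ofReal (M * r ^ n) := by
          rw [Finset.sum_const, Finset.card_product, nsmul_eq_mul, hM,
            ENNReal.ofReal_mul (by positivity), ← Nat.cast_mul, ENNReal.ofReal_natCast]
  have hsum1 : ∑' n : ℕ, (if n < N then (1 : ℝ≥0∞) else 0) = N := by
    rw [tsum_eq_sum (s := Finset.range N) (fun n hn => by simpa using hn)]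
    rw [Finset.sum_congr rfl (g := fun _ => (1 : ℝ≥0∞)) (fun n hn => by
      rw [if_pos (Finset.mem_range.1 hn)])]
    simp
  have hsum2 : ∑' n : ℕ, ENNReal.ofReal (M * r ^ n) = ENNReal.ofReal (M * (1 - r)⁻¹) := by
    rw [← ENNReal.ofReal_tsum_of_nonneg (fun n => by positivity)
      ((summable_geometric_of_lt_one hr0.le hr1).mul_left M), tsum_mul_left,
      tsum_geometric_of_lt_one hr0.le hr1]
  calc expectedSampleSize μ ρ A (gapRule K m μ ρ c)
      = ∑' n : ℕ, law μ ρ A {ω | WithTop.some n < gapTime K m μ ρ c ω} :=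
        lintegral_stoppingTime _ hT
    _ ≤ ∑' n : ℕ, ((if n < N then 1 else 0) + ENNReal.ofReal (M * r ^ n)) :=
        ENNReal.tsum_le_tsum htail
    _ = ENNReal.ofReal (N + M * (1 - r)⁻¹) := by
        rw [ENNReal.tsum_add, hsum1, hsum2, ENNReal.ofReal_add (by positivity)
          (by have := sub_pos.2 hr1; positivity), ENNReal.ofReal_natCast]
    _ ≤ _ := by
        refine ENNReal.ofReal_le_ofReal ?_
        have : (N : ℝ) ≤ b / (μ - δ) + 2 := by
          have := Nat.ceil_lt_add_one (a := b / (μ - δ)) (by positivity)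
          rw [hN]
          push_cast
          linarith
        linarith

/-! ### Error probabilities of the gap rule -/

theorem measurableSet_inter_stoppingTime_eq {K : ℕ} {T : Path K → WithTop ℕ}
    (hT : IsStoppingTime (dataFiltration K) T) {G : Set (Path K)}
    (hG : MeasurableSet[hT.measurableSpace] G) (n : ℕ) :
    MeasurableSet[dataFiltration K n] (G ∩ {ω | T ω = WithTop.some n}) := by
  have : G ∩ {ω | T ω = WithTop.some n} =
      (G ∩ {ω | T ω ≤ WithTop.some n}) ∩ {ω | T ω = WithTop.some n} := by
    ext ω
    simp only [Set.mem_inter_iff, Set.mem_ofPred_eq]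
    constructor
    · rintro ⟨h1, h2⟩
      exact ⟨⟨h1, h2.le⟩, h2⟩
    · rintro ⟨⟨h1, _⟩, h2⟩
      exact ⟨h1, h2⟩
  rw [this]
  exact (((hT.measurableSet _).1 hG).2 n).inter (hT.measurableSet_eq n)

theorem swapSignal_swapSignal {K : ℕ} {A : Finset (Fin K)} {i j : Fin K} (hi : i ∈ A)
    (hj : j ∉ A) : swapSignal (swapSignal A i j) j i = A := by
  rw [swapSignal, swapSignal, Finset.erase_insert (by simp [hj]), Finset.insert_erase hi]

theorem left_notMem_swapSignal {K : ℕ} {A : Finset (Fin K)} {i j : Fin K} (hi : i ∈ A)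
    (hj : j ∉ A) : i ∉ swapSignal A i j := by
  have hij : i ≠ j := fun h => hj (h ▸ hi)
  simp [swapSignal, hij]

theorem right_mem_swapSignal {K : ℕ} (A : Finset (Fin K)) (i j : Fin K) :
    j ∈ swapSignal A i j := by
  simp [swapSignal]

/-- The probability that the gap rule stops and ranks a noise stream `j` above the signal `i`. -/
theorem law_gapRule_inversion_le {K m : ℕ} (hm : 1 ≤ m) (hmK : m < K) {μ ρ : ℝ} (hμ : 0 < μ)
    (hρ0 : 0 ≤ ρ) (hρ1 : ρ < 1) {A : Finset (Fin K)} {i j : Fin K} (hi : i ∈ A) (hj : j ∉ A)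
    (c : ℝ) :
    law μ ρ A ({ω | j ∈ (gapRule K m μ ρ c).D ω ∧ i ∉ (gapRule K m μ ρ c).D ω} ∩
      {ω | gapTime K m μ ρ c ω ≠ ⊤}) ≤ ENNReal.ofReal (Real.exp (-c)) := by
  have hsub : 0 < 1 - ρ := sub_pos.2 hρ1
  obtain ⟨-, hT, hD⟩ := isSequentialTest_gapRule K m μ ρ c
  set G : Set (Path K) := {ω | j ∈ (gapRule K m μ ρ c).D ω ∧ i ∉ (gapRule K m μ ρ c).D ω} with hGdef
  have hG : MeasurableSet[hT.measurableSpace] G := (hD j).inter (hD i).compl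
  have hGn := measurableSet_inter_stoppingTime_eq hT hG
  have hmeas : MeasurableSet (G ∩ {ω | gapTime K m μ ρ c ω ≠ ⊤}) := by
    rw [inter_ne_top_eq_iUnion]
    exact MeasurableSet.iUnion fun n => (dataFiltration K).le n _ (hGn n)
  -- The change of measure is used backwards: the integral runs over the swapped law, and on the
  -- event the likelihood ratio `exp (μ / (1 - ρ) * (S_i - S_j))` is at most `exp (-c)`.
  have key := law_swapSignal_stopped (A := swapSignal A i j) (i := j) (j := i)
    (T := gapTime K m μ ρ c) μ hρ0 hρ1
    (right_mem_swapSignal A i j) (left_notMem_swapSignal hi hj) hGn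
  rw [swapSignal_swapSignal hi hj] at key
  rw [key]
  calc ∫⁻ ω in G ∩ {ω | gapTime K m μ ρ c ω ≠ ⊤}, ENNReal.ofReal
        (Real.exp (μ / (1 - ρ) * stoppedDiff (gapTime K m μ ρ c) i j ω))
          ∂(law μ ρ (swapSignal A i j))
      ≤ ∫⁻ _ω in G ∩ {ω | gapTime K m μ ρ c ω ≠ ⊤}, ENNReal.ofReal (Real.exp (-c))
          ∂(law μ ρ (swapSignal A i j)) := by
        refine setLIntegral_mono' hmeas fun ω hω => ?_
        refine ENNReal.ofReal_le_ofReal (Real.exp_le_exp.2 ?_)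
        have h1 := gap_le_stoppedDiff hm hmK hω.2 hω.1.1 hω.1.2
        rw [stoppedDiff_swap, mul_neg, neg_le_neg_iff]
        calc c = μ / (1 - ρ) * ((1 - ρ) / μ * c) := by field_simp
          _ ≤ _ := by gcongr
    _ ≤ ENNReal.ofReal (Real.exp (-c)) := by
        rw [setLIntegral_const]
        exact mul_le_of_le_one_right' prob_le_one

/-- A gap rule that selects a wrong set of streams ranks some noise stream above some signal. -/
theorem exists_inversion {K m : ℕ} (hmK : m ≤ K) {μ ρ c : ℝ} {A : Finset (Fin K)}
    (hA : A.card = m) {ω : Path K} (h : (gapRule K m μ ρ c).D ω ≠ A) :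
    ∃ i ∈ A, ∃ j ∉ A, j ∈ (gapRule K m μ ρ c).D ω ∧ i ∉ (gapRule K m μ ρ c).D ω := by
  have hcard : ((gapRule K m μ ρ c).D ω).card = m := card_topStreams hmK _
  obtain ⟨j, hj, hjA⟩ := Finset.not_subset.1 fun hsub =>
    h (Finset.eq_of_subset_of_card_le hsub (by omega))
  obtain ⟨i, hi, hiT⟩ := Finset.not_subset.1 fun hsub =>
    h (Finset.eq_of_subset_of_card_le hsub (by omega)).symm
  exact ⟨i, hi, j, hjA, hj, hiT⟩

theorem law_gapRule_ne_le {K m : ℕ} (hm : 1 ≤ m) (hmK : m < K) {μ ρ : ℝ} (hμ : 0 < μ)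
    (hρ0 : 0 ≤ ρ) (hρ1 : ρ < 1) {A : Finset (Fin K)} (hA : A.card = m) {c : ℝ} (hc : 0 < c) :
    (law μ ρ A).real {ω | (gapRule K m μ ρ c).D ω ≠ A} ≤ m * ((K : ℝ) - m) * Real.exp (-c) := by
  have hT := isStoppingTime_gapTime K m μ ρ c
  -- Any `δ` in `(0, μ)` would do: only almost sure termination is needed, so that decisions without
  -- stopping do not count.
  obtain ⟨C, -, hC⟩ := expectedSampleSize_gapRule_le hm hmK hρ0 hρ1 (half_pos hμ)
    (half_lt_self hμ) hA
  have hae : ∀ᵐ ω ∂(law μ ρ A), gapTime K m μ ρ c ω ≠ ⊤ :=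
    ae_ne_top_of_lintegral_ne_top hT (ne_top_of_le_ne_top ENNReal.ofReal_ne_top (hC c hc))
  have hAc : ((Aᶜ.card : ℕ) : ℝ) = (K : ℝ) - m := by
    rw [Finset.card_compl, Fintype.card_fin, hA, Nat.cast_sub hmK.le]
  refine ENNReal.toReal_le_of_le_ofReal
    (by rw [← hAc]; positivity) ?_
  calc law μ ρ A {ω | (gapRule K m μ ρ c).D ω ≠ A}
      ≤ law μ ρ A (⋃ q ∈ A ×ˢ Aᶜ,
          ({ω | q.2 ∈ (gapRule K m μ ρ c).D ω ∧ q.1 ∉ (gapRule K m μ ρ c).D ω} ∩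
            {ω | gapTime K m μ ρ c ω ≠ ⊤})) := by
        refine measure_mono_ae ?_
        filter_upwards [hae] with ω hω hne
        obtain ⟨i, hi, j, hj, h⟩ := exists_inversion hmK.le hA hne
        change ω ∈ ⋃ q ∈ A ×ˢ Aᶜ, _
        simp only [Set.mem_iUnion, exists_prop]
        exact ⟨(i, j), by simp [hi, hj], h, hω⟩
    _ ≤ ∑ q ∈ A ×ˢ Aᶜ, ENNReal.ofReal (Real.exp (-c)) := by
        refine (measure_biUnion_finset_le _ _).trans (Finset.sum_le_sum fun q hq => ?_)
        simp only [Finset.mem_product, Finset.mem_compl] at hq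
        exact law_gapRule_inversion_le hm hmK hμ hρ0 hρ1 hq.1 hq.2 c
    _ = ENNReal.ofReal (m * ((K : ℝ) - m) * Real.exp (-c)) := by
        rw [Finset.sum_const, Finset.card_product, nsmul_eq_mul, ENNReal.ofReal_mul
          (by rw [← hAc]; positivity), ← hAc, hA, ← Nat.cast_mul, ENNReal.ofReal_natCast]

/-! ### Wald's identity and the information lower bound -/

theorem integrable_sub_law {K : ℕ} (μ ρ : ℝ) (A : Finset (Fin K)) (i j : Fin K) (n : ℕ) :
    Integrable (fun ω : Path K => ω n i - ω n j) (law μ ρ A) := by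
  have h : Integrable (fun x : EuclideanSpace ℝ (Fin K) => x i - x j)
      (multivariateGaussian (meanVec μ A) (equicorr K ρ)) := by
    have h1 : Integrable (fun x => x) (multivariateGaussian (meanVec μ A) (equicorr K ρ)) :=
      IsGaussian.integrable_id
    exact (h1.eval_piLp i).sub (h1.eval_piLp j)
  exact (measurePreserving_eval_law μ ρ A n).integrable_comp_of_integrable h

theorem integral_sub_law {K : ℕ} {A : Finset (Fin K)} {i j : Fin K} (μ : ℝ) {ρ : ℝ}
    (h0 : 0 ≤ ρ) (h1 : ρ < 1) (hi : i ∈ A) (hj : j ∉ A) (n : ℕ) :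
    ∫ ω, (ω n i - ω n j) ∂(law μ ρ A) = μ := by
  have : ∫ y, y ∂((law μ ρ A).map fun ω => ω n i - ω n j) = μ := by
    rw [map_sub_law μ h0 h1 hi hj, integral_id_gaussianReal]
  rwa [integral_map (by fun_prop) (by fun_prop)] at this

/-- Wald's identity for the difference of a signal stream and a noise stream. -/
theorem integral_stoppedDiff {K : ℕ} {A : Finset (Fin K)} {i j : Fin K} (μ : ℝ) {ρ : ℝ}
    (h0 : 0 ≤ ρ) (h1 : ρ < 1) (hi : i ∈ A) (hj : j ∉ A) {T : Path K → WithTop ℕ}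
    (hT : IsStoppingTime (dataFiltration K) T)
    (hfin : ∫⁻ ω, ENat.toENNReal (T ω) ∂(law μ ρ A) ≠ ⊤) :
    Integrable (stoppedDiff T i j) (law μ ρ A) ∧
      ∫ ω, stoppedDiff T i j ω ∂(law μ ρ A) =
        (∫⁻ ω, ENat.toENNReal (T ω) ∂(law μ ρ A)).toReal * μ := by
  set P := law μ ρ A with hP
  let S : ℕ → Set (Path K) := fun n => {ω | WithTop.some n < T ω}
  have hS : ∀ n, MeasurableSet (S n) := measurableSet_lt_stoppingTime hT
  let Y : ℕ → Path K → ℝ := fun n ω => ω n i - ω n j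
  have hY : ∀ n, Integrable (Y n) P := integrable_sub_law μ ρ A i j
  let F : ℕ → Path K → ℝ := fun n => (S n).indicator (Y n)
  have hF : ∀ n, Integrable (F n) P := fun n => (hY n).indicator (hS n)
  have hsum : ∑' n, P (S n) ≠ ⊤ := by rwa [← lintegral_stoppingTime P hT]
  have hmul : ∀ (g : ℝ → ℝ), Measurable g → ∀ n,
      ∫ ω, (S n).indicator (fun ω => g (Y n ω)) ω ∂P = P.real (S n) * ∫ ω, g (Y n ω) ∂P := by
    intro g hg n
    -- The event `n < T` depends on `ω 0, …, ω (n - 1)` only, hence is independent of the increment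
    -- at index `n`.
    have hind : IndepFun ((S n).indicator (fun _ => (1 : ℝ))) (fun ω => g (Y n ω)) P := by
      rw [IndepFun_iff_Indep]
      refine indep_of_indep_of_le_left (indep_of_indep_of_le_right
        (indep_dataFiltration_eval μ ρ A n) ?_) ?_
      · have : (fun ω => g (Y n ω)) = (fun x : EuclideanSpace ℝ (Fin K) => g (x i - x j)) ∘
            fun ω : Path K => ω n := rfl
        rw [this, ← MeasurableSpace.comap_comp]
        exact MeasurableSpace.comap_mono (by
          have : Measurable (fun x : EuclideanSpace ℝ (Fin K) => g (x i - x j)) := by fun_prop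
          exact this.comap_le)
      · exact Measurable.comap_le (Measurable.indicator (measurable_const)
          (hT.measurableSet_gt n))
    have heq : ∀ ω, (S n).indicator (fun ω => g (Y n ω)) ω =
        (S n).indicator (fun _ => (1 : ℝ)) ω * g (Y n ω) := by
      intro ω
      by_cases h : ω ∈ S n <;> simp [h]
    simp_rw [heq]
    have hYm : Measurable (Y n) := by fun_prop
    rw [hind.integral_fun_mul_eq_mul_integral
      (measurable_const.indicator (hS n)).aestronglyMeasurable
      (hg.comp hYm).aestronglyMeasurable, integral_indicator_const _ (hS n), smul_eq_mul, mul_one]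
  have hdist : ∀ n, ∫ ω, |Y n ω| ∂P = ∫ y, |y| ∂(gaussianReal μ (2 * (1 - ρ)).toNNReal) := by
    intro n
    rw [← map_sub_law μ h0 h1 hi hj n, integral_map (by fun_prop) (by fun_prop)]
  have hnorm : ∀ n, ∫ ω, ‖F n ω‖ ∂P =
      P.real (S n) * ∫ y, |y| ∂(gaussianReal μ (2 * (1 - ρ)).toNNReal) := by
    intro n
    rw [← hdist n, ← hmul (fun x => |x|) measurable_norm n]
    congr 1
    ext1 ω
    by_cases h : ω ∈ S n <;> simp [F, h]
  have hsummable : Summable fun n => P.real (S n) := ENNReal.summable_toReal hsum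
  -- The absolute increments share one finite mean and the probabilities of `n < T` sum to the
  -- expectation of `T`; this allows sum and integral to be exchanged.
  have hsumnorm : Summable fun n => ∫ ω, ‖F n ω‖ ∂P := by
    simp_rw [hnorm]
    exact hsummable.mul_right _
  have hae : ∀ᵐ ω ∂P, T ω ≠ ⊤ := ae_ne_top_of_lintegral_ne_top hT hfin
  have hpt : ∀ ω, T ω ≠ ⊤ → HasSum (fun n => F n ω) (stoppedDiff T i j ω) := by
    intro ω hω
    obtain ⟨N, hN⟩ := WithTop.ne_top_iff_exists.1 hω
    have hval : stoppedDiff T i j ω = ∑ n ∈ Finset.range N, F n ω := by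
      rw [stoppedDiff, ← hN, WithTop.untopD_coe, partialSum, partialSum, ← Finset.sum_sub_distrib]
      refine Finset.sum_congr rfl fun n hn => ?_
      refine (Set.indicator_of_mem (?_ : ω ∈ S n) (Y n)).symm
      change WithTop.some n < T ω
      rw [← hN]
      exact WithTop.coe_lt_coe.2 (Finset.mem_range.1 hn)
    rw [hval]
    refine hasSum_sum_of_ne_finset_zero fun n hn => ?_
    refine Set.indicator_of_notMem (fun h => ?_) _
    change WithTop.some n < T ω at h
    rw [← hN] at h
    exact hn (Finset.mem_range.2 (WithTop.coe_lt_coe.1 h))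
  have htsum : (fun ω => ∑' n, F n ω) =ᵐ[P] stoppedDiff T i j := by
    filter_upwards [hae] with ω hω
    exact (hpt ω hω).tsum_eq
  have hHas := hasSum_integral_of_summable_integral_norm hF hsumnorm
  refine ⟨?_, ?_⟩
  · refine (Integrable.congr ?_ htsum)
    have hFm : ∀ n, Measurable (F n) := by
      intro n
      have hYm : Measurable (Y n) := by fun_prop
      exact hYm.indicator (hS n)
    refine ⟨(Measurable.tsum hFm).aestronglyMeasurable, ?_⟩
    refine lt_of_le_of_lt (b := ∑' n, ∫⁻ ω, ‖F n ω‖ₑ ∂P) ?_ ?_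
    · rw [← lintegral_tsum fun n => (hF n).1.enorm]
      exact lintegral_mono fun ω => enorm_tsum_le_tsum_enorm
    · have : ∀ n, ∫⁻ ω, ‖F n ω‖ₑ ∂P = ENNReal.ofReal (∫ ω, ‖F n ω‖ ∂P) := fun n =>
        (ofReal_integral_norm_eq_lintegral_enorm (hF n)).symm
      simp_rw [this]
      rw [← ENNReal.ofReal_tsum_of_nonneg (fun n => integral_nonneg fun _ => norm_nonneg _)
        hsumnorm]
      exact ENNReal.ofReal_lt_top
  · rw [← integral_congr_ae htsum, ← hHas.tsum_eq, lintegral_stoppingTime P hT,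
      ENNReal.tsum_toReal_eq (fun n => measure_ne_top P _), ← tsum_mul_right]
    congr 1
    ext1 n
    have := hmul id measurable_id n
    simp only [id] at this
    rw [integral_sub_law μ h0 h1 hi hj n] at this
    exact this

/-- The pointwise inequality behind the bound on the Kullback–Leibler divergence of two laws in
terms of the probabilities they give to one event. -/
theorem log_inv_add_one_sub_le {q z : ℝ} (hq : 0 < q) :
    Real.log q⁻¹ + 1 - Real.exp (-z) / q ≤ z := by
  have h := Real.add_one_le_exp (-z - Real.log q)
  rw [Real.exp_sub, Real.exp_log hq] at h
  rw [Real.log_inv]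
  linarith

/-- Information inequality: a stopping time whose σ-field contains an event `G` that is likely under
the signal set `A` and has probability at most `q` when the signal `i` is replaced by `j`. -/
theorem information_lower_bound {K : ℕ} {A : Finset (Fin K)} {i j : Fin K} {μ ρ : ℝ}
    (hμ : 0 < μ) (h0 : 0 ≤ ρ) (h1 : ρ < 1) (hi : i ∈ A) (hj : j ∉ A) {T : Path K → WithTop ℕ}
    (hT : IsStoppingTime (dataFiltration K) T) {G : Set (Path K)}
    (hG : MeasurableSet[hT.measurableSpace] G) {q : ℝ} (hq : 0 < q)
    (hGq : (law μ ρ (swapSignal A i j)).real G ≤ q) :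
    ENNReal.ofReal ((1 - ρ) / μ ^ 2 * ((law μ ρ A).real G * Real.log q⁻¹ - 1)) ≤
      ∫⁻ ω, ENat.toENNReal (T ω) ∂(law μ ρ A) := by
  have hsub : 0 < 1 - ρ := sub_pos.2 h1
  set P := law μ ρ A with hP
  by_cases hfin : ∫⁻ ω, ENat.toENNReal (T ω) ∂P = ⊤
  · rw [hfin]
    exact le_top
  obtain ⟨hint, hwald⟩ := integral_stoppedDiff μ h0 h1 hi hj hT hfin
  have hae : ∀ᵐ ω ∂P, T ω ≠ ⊤ := ae_ne_top_of_lintegral_ne_top hT hfin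
  set θ := μ / (1 - ρ) with hθ
  set Z : Path K → ℝ := fun ω => θ * stoppedDiff T i j ω with hZ
  have hZint : Integrable Z P := hint.const_mul θ
  have hmeas : ∀ G : Set (Path K), MeasurableSet[hT.measurableSpace] G → MeasurableSet G :=
    fun G h => hT.measurableSpace_le _ h
  have hexp : ∀ G : Set (Path K), MeasurableSet[hT.measurableSpace] G →
      ∫⁻ ω in G, ENNReal.ofReal (Real.exp (-Z ω)) ∂P ≤ law μ ρ (swapSignal A i j) G := by
    intro G hG
    have h := law_swapSignal_stopped μ h0 h1 hi hj (measurableSet_inter_stoppingTime_eq hT hG)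
    -- Paths with `T = ⊤` are null under `A` but perhaps not under the swapped law, hence only an
    -- inequality.
    have hset : (G ∩ {ω | T ω ≠ ⊤} : Set (Path K)) =ᵐ[P] G := by
      filter_upwards [hae] with ω hω
      exact propext ⟨fun h => h.1, fun h => ⟨h, hω⟩⟩
    rw [setLIntegral_congr hset] at h
    refine le_trans (le_of_eq ?_) (h.symm.trans_le (measure_mono Set.inter_subset_left))
    congr 1
    ext1 ω
    rw [stoppedDiff_swap T j i, mul_neg]
  have hZm : AEStronglyMeasurable (fun ω => Real.exp (-Z ω)) P :=
    Real.continuous_exp.comp_aestronglyMeasurable hZint.1.neg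
  have hEint : Integrable (fun ω => Real.exp (-Z ω)) P := by
    refine ⟨hZm, ?_⟩
    rw [hasFiniteIntegral_iff_ofReal (ae_of_all _ fun _ => (Real.exp_pos _).le),
      ← setLIntegral_univ]
    exact (hexp _ (@MeasurableSet.univ _ hT.measurableSpace)).trans_lt (measure_lt_top _ _)
  have hexp' : ∀ G : Set (Path K), MeasurableSet[hT.measurableSpace] G →
      ∫ ω in G, Real.exp (-Z ω) ∂P ≤ (law μ ρ (swapSignal A i j)).real G := by
    intro G hG
    rw [integral_eq_lintegral_of_nonneg_ae (ae_of_all _ fun _ => (Real.exp_pos _).le)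
      hZm.restrict]
    exact ENNReal.toReal_mono (measure_ne_top _ _) (hexp G hG)
  have hGc : MeasurableSet[hT.measurableSpace] Gᶜ := hG.compl
  -- The integral of `exp (-Z)` over `G` is at most `q`, so the pointwise bound loses at most `1`
  -- after integration.
  have hI1 : P.real G * (Real.log q⁻¹ + 1) - 1 ≤ ∫ ω in G, Z ω ∂P := by
    have hle : ∫ ω in G, (Real.log q⁻¹ + 1 - Real.exp (-Z ω) / q) ∂P ≤ ∫ ω in G, Z ω ∂P :=
      integral_mono ((integrable_const _).sub (hEint.integrableOn.div_const q))
        hZint.integrableOn fun ω => log_inv_add_one_sub_le hq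
    rw [integral_sub (integrable_const _) (hEint.integrableOn.div_const q), integral_div,
      setIntegral_const, smul_eq_mul] at hle
    have : (∫ ω in G, Real.exp (-Z ω) ∂P) / q ≤ 1 := by
      rw [div_le_one hq]
      exact (hexp' G hG).trans hGq
    linarith
  -- The same bound with `q = 1` suffices on the complement. Adding the two, `P(G) + P(Gᶜ) = 1`
  -- absorbs one of the two losses.
  have hI2 : P.real Gᶜ - 1 ≤ ∫ ω in Gᶜ, Z ω ∂P := by
    have hle : ∫ ω in Gᶜ, (1 - Real.exp (-Z ω)) ∂P ≤ ∫ ω in Gᶜ, Z ω ∂P :=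
      integral_mono ((integrable_const _).sub hEint.integrableOn)
        hZint.integrableOn fun ω => by
          have := log_inv_add_one_sub_le (q := 1) (z := Z ω) one_pos
          simpa using this
    rw [integral_sub (integrable_const _) hEint.integrableOn,
      setIntegral_const, smul_eq_mul, mul_one] at hle
    have := (hexp' Gᶜ hGc).trans measureReal_le_one
    linarith
  have hsplit : ∫ ω in G, Z ω ∂P + ∫ ω in Gᶜ, Z ω ∂P = ∫ ω, Z ω ∂P :=
    integral_add_compl (hmeas G hG) hZint
  have hprob : P.real G + P.real Gᶜ = 1 := probReal_add_probReal_compl (hmeas G hG)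
  have htot : ∫ ω, Z ω ∂P = θ * ((∫⁻ ω, ENat.toENNReal (T ω) ∂P).toReal * μ) := by
    rw [hZ, integral_const_mul, hwald]
  rw [htot] at hsplit
  rw [← ENNReal.ofReal_toReal hfin]
  refine ENNReal.ofReal_le_ofReal ?_
  set E := (∫⁻ ω, ENat.toENNReal (T ω) ∂P).toReal
  calc (1 - ρ) / μ ^ 2 * (P.real G * Real.log q⁻¹ - 1) ≤ (1 - ρ) / μ ^ 2 * (θ * (E * μ)) := by
        gcongr
        linarith
    _ = E := by
        rw [hθ]
        field_simp

theorem IsSequentialTest.measurableSet_D_eq {K : ℕ} {p : Procedure K} {T : Path K → WithTop ℕ}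
    (hT : IsStoppingTime (dataFiltration K) T)
    (hD : ∀ i, MeasurableSet[hT.measurableSpace] {ω | i ∈ p.D ω}) (B : Finset (Fin K)) :
    MeasurableSet[hT.measurableSpace] {ω | p.D ω = B} := by
  have : {ω | p.D ω = B} =
      ⋂ i, ({ω | i ∈ p.D ω} ∩ {_ω | i ∈ B}) ∪ ({ω | i ∈ p.D ω}ᶜ ∩ {_ω | i ∉ B}) := by
    ext ω
    simp only [Set.mem_ofPred_eq, Finset.ext_iff, Set.mem_iInter, Set.mem_union, Set.mem_inter_iff,
      Set.mem_compl_iff, iff_iff_and_or_not_and_not]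
  rw [this]
  exact MeasurableSet.iInter fun i => ((hD i).inter (MeasurableSet.const _)).union
    ((hD i).compl.inter (MeasurableSet.const _))

theorem IsSequentialTest.measurable_D {K : ℕ} {p : Procedure K} (hp : IsSequentialTest p) :
    @Measurable _ _ _ ⊤ p.D := by
  obtain ⟨-, hT, hD⟩ := hp
  refine @measurable_to_countable' _ _ ⊤ _ _ _ fun B => ?_
  exact hT.measurableSpace_le _ (measurableSet_D_eq hT hD B)

theorem one_le_falseRejections_iff {K : ℕ} {A : Finset (Fin K)} {p : Procedure K} {ω : Path K} :
    1 ≤ falseRejections A p ω ↔ ¬p.D ω ⊆ A := by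
  rw [falseRejections, Nat.one_le_iff_ne_zero, Ne, Finset.card_eq_zero,
    Finset.sdiff_eq_empty_iff_subset]

theorem one_le_falseAcceptances_iff {K : ℕ} {A : Finset (Fin K)} {p : Procedure K} {ω : Path K} :
    1 ≤ falseAcceptances A p ω ↔ ¬A ⊆ p.D ω := by
  rw [falseAcceptances, Nat.one_le_iff_ne_zero, Ne, Finset.card_eq_zero,
    Finset.sdiff_eq_empty_iff_subset]

/-- Lower bound for the expected sample size of a test that controls both familywise error rates. -/
theorem le_expectedSampleSize {K m : ℕ} (hm : 1 ≤ m) (hmK : m < K) {μ ρ : ℝ} (hμ : 0 < μ)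
    (h0 : 0 ≤ ρ) (h1 : ρ < 1) {A : Finset (Fin K)} (hA : A.card = m) {p : Procedure K}
    (hp : IsSequentialTest p) {a b : ℝ} (ha : 0 < a) (hb : 0 < b) (hq1 : min a b ≤ 1)
    (hF : ∀ B ∈ signalClass K m, (FWER K μ ρ).type1 B p ≤ a ∧ (FWER K μ ρ).type2 B p ≤ b) :
    ENNReal.ofReal ((1 - ρ) / μ ^ 2 * ((1 - a - b) * Real.log (min a b)⁻¹ - 1)) ≤
      expectedSampleSize μ ρ A p := by
  have hsub : 0 < 1 - ρ := sub_pos.2 h1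
  have hq : 0 < min a b := lt_min ha hb
  obtain ⟨-, hT, hD⟩ := hp
  obtain ⟨i, hi⟩ : A.Nonempty := Finset.card_pos.1 (by omega)
  obtain ⟨j, hj⟩ : ∃ j, j ∉ A := by
    by_contra! h
    have : A = Finset.univ := Finset.eq_univ_iff_forall.2 h
    rw [this, Finset.card_univ, Fintype.card_fin] at hA
    omega
  have hGm := IsSequentialTest.measurableSet_D_eq hT hD A
  obtain ⟨hA1, hA2⟩ := hF A hA
  obtain ⟨hB1, hB2⟩ := hF (swapSignal A i j) ((card_swapSignal hi hj).trans hA)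
  -- Selecting `A` after the swap rejects `i` falsely and accepts `j` falsely, so both error levels
  -- bound this probability.
  have hGq : (law μ ρ (swapSignal A i j)).real {ω | p.D ω = A} ≤ min a b := by
    refine le_min ((measureReal_mono fun ω hω => ?_).trans hB1)
      ((measureReal_mono fun ω hω => ?_).trans hB2)
    · refine one_le_falseRejections_iff.2 fun h => left_notMem_swapSignal hi hj (h ?_)
      exact (Eq.subset (Eq.symm hω)) hi
    · refine one_le_falseAcceptances_iff.2 fun h => hj ?_
      exact (Eq.subset hω) (h (right_mem_swapSignal A i j))
  have hGp : 1 - a - b ≤ (law μ ρ A).real {ω | p.D ω = A} := by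
    have hc : (law μ ρ A).real {ω | p.D ω = A}ᶜ ≤ a + b := by
      refine (measureReal_mono (s₂ := {ω | 1 ≤ falseRejections A p ω} ∪
        {ω | 1 ≤ falseAcceptances A p ω}) fun ω hω => ?_).trans
        ((measureReal_union_le _ _).trans (add_le_add hA1 hA2))
      by_contra hcon
      simp only [Set.mem_union, Set.mem_ofPred_eq, one_le_falseRejections_iff,
        one_le_falseAcceptances_iff, not_or, not_not] at hcon
      exact hω (hcon.1.antisymm hcon.2)
    have := probReal_add_probReal_compl (μ := law μ ρ A) (hT.measurableSpace_le _ hGm)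
    linarith
  refine le_trans (ENNReal.ofReal_le_ofReal ?_)
    (information_lower_bound hμ h0 h1 hi hj hT hGm hq hGq)
  have hlog : 0 ≤ Real.log (min a b)⁻¹ := Real.log_nonneg ((one_le_inv₀ hq).2 hq1)
  gcongr

/-! ### Comparison of the discovery rates with the familywise error rates -/

theorem IsSequentialTest.measurableSet_preimage_D {K : ℕ} {p : Procedure K}
    (hp : IsSequentialTest p) (S : Set (Finset (Fin K))) : MeasurableSet {ω | p.D ω ∈ S} :=
  hp.measurable_D (MeasurableSpace.measurableSet_top (s := S))

theorem IsSequentialTest.integrable_comp_D {K : ℕ} {p : Procedure K} (hp : IsSequentialTest p)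
    (Q : Measure (Path K)) [IsFiniteMeasure Q] (f : Finset (Fin K) → ℝ) :
    Integrable (fun ω => f (p.D ω)) Q := by
  have hm : Measurable (fun ω => f (p.D ω)) :=
    (@measurable_from_top _ _ _ f).comp hp.measurable_D
  refine Integrable.of_bound hm.aestronglyMeasurable (∑ B, ‖f B‖) (ae_of_all _ fun ω => ?_)
  exact Finset.single_le_sum (f := fun B => ‖f B‖) (fun B _ => norm_nonneg _) (Finset.mem_univ _)

theorem IsSequentialTest.mul_measureReal_le_integral {K : ℕ} {p : Procedure K}
    (hp : IsSequentialTest p) (Q : Measure (Path K)) [IsFiniteMeasure Q] {f : Finset (Fin K) → ℝ}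
    {S : Set (Finset (Fin K))} {c : ℝ} (hf : ∀ B, 0 ≤ f B) (hS : ∀ B ∈ S, c ≤ f B) :
    c * Q.real {ω | p.D ω ∈ S} ≤ ∫ ω, f (p.D ω) ∂Q := by
  have hSm := hp.measurableSet_preimage_D S
  rw [mul_comm, ← smul_eq_mul, ← integral_indicator_const c hSm]
  refine integral_mono ((integrable_const c).indicator hSm) (hp.integrable_comp_D Q f) fun ω => ?_
  by_cases h : p.D ω ∈ S
  · rw [Set.indicator_of_mem (s := {ω | p.D ω ∈ S}) h]
    exact hS _ h
  · rw [Set.indicator_of_notMem (s := {ω | p.D ω ∈ S}) h]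
    exact hf _

theorem IsSequentialTest.integral_le_measureReal {K : ℕ} {p : Procedure K}
    (hp : IsSequentialTest p) (Q : Measure (Path K)) [IsFiniteMeasure Q] {f : Finset (Fin K) → ℝ}
    {S : Set (Finset (Fin K))} (hf : ∀ B, f B ≤ 1) (hS : ∀ B ∉ S, f B ≤ 0) :
    ∫ ω, f (p.D ω) ∂Q ≤ Q.real {ω | p.D ω ∈ S} := by
  have hSm := hp.measurableSet_preimage_D S
  rw [← integral_indicator_one hSm]
  refine integral_mono (hp.integrable_comp_D Q f) ((integrable_const 1).indicator hSm) fun ω => ?_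
  by_cases h : p.D ω ∈ S
  · rw [Set.indicator_of_mem (s := {ω | p.D ω ∈ S}) h]
    exact hf _
  · rw [Set.indicator_of_notMem (s := {ω | p.D ω ∈ S}) h]
    exact hS _ h

/-- Division by a probability can only increase; if `S` is null, so is `E`, which matches the
convention for null conditioning events. -/
theorem measureReal_le_cond {Ω : Type*} [MeasurableSpace Ω] (P : Measure Ω) [IsProbabilityMeasure P]
    {S E : Set Ω} (hS : MeasurableSet S) (h : E ⊆ S) : P.real E ≤ (cond P S).real E := by
  rw [measureReal_def (cond P S), cond_apply hS, Set.inter_eq_self_of_subset_right h,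
    ENNReal.toReal_mul, ENNReal.toReal_inv, ← measureReal_def, ← measureReal_def]
  rcases eq_or_lt_of_le (measureReal_nonneg (μ := P) (s := S)) with h0 | h0
  · rw [← h0, inv_zero, zero_mul, h0]
    exact measureReal_mono h
  · exact le_mul_of_one_le_left measureReal_nonneg ((one_le_inv₀ h0).2 measureReal_le_one)

theorem card_sdiff_le_sub {K : ℕ} (A B : Finset (Fin K)) :
    ((A \ B).card : ℝ) ≤ (K : ℝ) - (B.card : ℝ) := by
  have h : (A \ B).card ≤ Bᶜ.card := Finset.card_le_card fun i hi =>
    Finset.mem_compl.2 (Finset.mem_sdiff.1 hi).2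
  rw [Finset.card_compl, Fintype.card_fin] at h
  have hB : B.card ≤ K := by simpa using Finset.card_le_univ B
  rw [← Nat.cast_sub hB]
  exact_mod_cast h

theorem card_sdiff_le_card {K : ℕ} (A B : Finset (Fin K)) :
    ((B \ A).card : ℝ) ≤ (B.card : ℝ) := by
  exact_mod_cast Finset.card_le_card Finset.sdiff_subset

theorem card_le_real {K : ℕ} (B : Finset (Fin K)) : (B.card : ℝ) ≤ K := by
  exact_mod_cast (by simpa using Finset.card_le_univ B : B.card ≤ K)

theorem one_div_le_div {v r k : ℝ} (hv : 1 ≤ v) (hvr : v ≤ r) (hrk : r ≤ k) : 1 / k ≤ v / r :=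
  div_le_div₀ (by linarith) hv (by linarith) hrk

theorem FDR_FNR_universalLowerBound (K m : ℕ) (hK : 1 ≤ K) (μ ρ : ℝ) :
    UniversalLowerBound K m μ ρ (FDR_FNR K μ ρ) (1 / (K : ℝ)) := by
  have hK' : (1 : ℝ) ≤ K := by exact_mod_cast hK
  intro A _ p hp
  constructor
  · refine hp.mul_measureReal_le_integral (law μ ρ A)
      (f := fun B => ((B \ A).card : ℝ) / max (B.card : ℝ) 1) (S := {B | 1 ≤ (B \ A).card})
      (fun B => by positivity) fun B hB => ?_
    exact one_div_le_div (by exact_mod_cast hB) (le_max_of_le_left (card_sdiff_le_card A B))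
      (max_le (card_le_real B) hK')
  · refine hp.mul_measureReal_le_integral (law μ ρ A)
      (f := fun B => ((A \ B).card : ℝ) / max ((K : ℝ) - (B.card : ℝ)) 1)
      (S := {B | 1 ≤ (A \ B).card})
      (fun B => by positivity) fun B hB => ?_
    exact one_div_le_div (by exact_mod_cast hB) (le_max_of_le_left (card_sdiff_le_sub A B))
      (max_le (by linarith [(Nat.cast_nonneg B.card : (0 : ℝ) ≤ B.card)]) hK')

theorem FDR_FNR_gapRuleUpperBound (K m : ℕ) (μ ρ : ℝ) :
    GapRuleUpperBound K m μ ρ (FDR_FNR K μ ρ) 1 := by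
  intro A _ c _
  have hp := isSequentialTest_gapRule K m μ ρ c
  rw [one_mul, one_mul]
  constructor
  · refine hp.integral_le_measureReal (law μ ρ A)
      (f := fun B => ((B \ A).card : ℝ) / max (B.card : ℝ) 1) (S := {B | 1 ≤ (B \ A).card})
      (fun B => ?_) fun B hB => ?_
    · exact div_le_one_of_le₀ (le_max_of_le_left (card_sdiff_le_card A B)) (by positivity)
    · have : (B \ A).card = 0 := by simpa using hB
      simp [this]
  · refine hp.integral_le_measureReal (law μ ρ A)
      (f := fun B => ((A \ B).card : ℝ) / max ((K : ℝ) - (B.card : ℝ)) 1)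
      (S := {B | 1 ≤ (A \ B).card}) (fun B => ?_) fun B hB => ?_
    · exact div_le_one_of_le₀ (le_max_of_le_left (card_sdiff_le_sub A B)) (by positivity)
    · have : (A \ B).card = 0 := by simpa using hB
      simp [this]

theorem pFDR_pFNR_universalLowerBound (K m : ℕ) (μ ρ : ℝ) :
    UniversalLowerBound K m μ ρ (pFDR_pFNR K μ ρ) (1 / (K : ℝ)) := by
  intro A _ p hp
  constructor
  · have h := measureReal_le_cond (law μ ρ A)
      (hp.measurableSet_preimage_D {B | 1 ≤ B.card}) (E := {ω | 1 ≤ falseRejections A p ω})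
      fun ω (hω : 1 ≤ (p.D ω \ A).card) => hω.trans (Finset.card_le_card Finset.sdiff_subset)
    refine (mul_le_mul_of_nonneg_left h (by positivity)).trans ?_
    refine hp.mul_measureReal_le_integral (cond (law μ ρ A) {ω | 1 ≤ rejections p ω})
      (f := fun B => ((B \ A).card : ℝ) / (B.card : ℝ)) (S := {B | 1 ≤ (B \ A).card})
      (fun B => by positivity) fun B hB => ?_
    exact one_div_le_div (by exact_mod_cast hB) (card_sdiff_le_card A B) (card_le_real B)
  · have h := measureReal_le_cond (law μ ρ A)
      (hp.measurableSet_preimage_D {B | 1 ≤ (K : ℝ) - (B.card : ℝ)})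
      (E := {ω | 1 ≤ falseAcceptances A p ω})
      fun ω (hω : 1 ≤ (A \ p.D ω).card) => by
        refine le_trans ?_ (card_sdiff_le_sub A (p.D ω))
        exact_mod_cast hω
    refine (mul_le_mul_of_nonneg_left h (by positivity)).trans ?_
    refine hp.mul_measureReal_le_integral
      (cond (law μ ρ A) {ω | 1 ≤ (K : ℝ) - (rejections p ω : ℝ)})
      (f := fun B => ((A \ B).card : ℝ) / ((K : ℝ) - (B.card : ℝ)))
      (S := {B | 1 ≤ (A \ B).card})
      (fun B => div_nonneg (by positivity) (sub_nonneg.2 (card_le_real B))) fun B hB => ?_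
    exact one_div_le_div (by exact_mod_cast hB) (card_sdiff_le_sub A B)
      (by linarith [(Nat.cast_nonneg B.card : (0 : ℝ) ≤ B.card)])

/-- The gap rule always rejects exactly `m` hypotheses, with `1 ≤ m < K`, so both conditioning
events are the whole space. -/
theorem pFDR_pFNR_gapRuleUpperBound {K m : ℕ} (hm : 1 ≤ m) (hmK : m < K) (μ ρ : ℝ) :
    GapRuleUpperBound K m μ ρ (pFDR_pFNR K μ ρ) 1 := by
  intro A _ c _
  have hp := isSequentialTest_gapRule K m μ ρ c
  have hcard : ∀ ω, rejections (gapRule K m μ ρ c) ω = m := fun ω => card_topStreams hmK.le _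
  rw [one_mul, one_mul]
  constructor
  · have huniv : {ω | 1 ≤ rejections (gapRule K m μ ρ c) ω} = Set.univ :=
      Set.eq_univ_of_forall fun ω => by
        change 1 ≤ _
        rw [hcard]
        exact hm
    change ∫ ω, _ ∂(cond (law μ ρ A) {ω | 1 ≤ rejections (gapRule K m μ ρ c) ω}) ≤ _
    rw [huniv, cond_univ]
    refine hp.integral_le_measureReal (law μ ρ A)
      (f := fun B => ((B \ A).card : ℝ) / (B.card : ℝ)) (S := {B | 1 ≤ (B \ A).card})
      (fun B => ?_) fun B hB => ?_
    · exact div_le_one_of_le₀ (card_sdiff_le_card A B) (by positivity)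
    · have : (B \ A).card = 0 := by simpa using hB
      simp [this]
  · have huniv : {ω | 1 ≤ (K : ℝ) - (rejections (gapRule K m μ ρ c) ω : ℝ)} = Set.univ :=
      Set.eq_univ_of_forall fun ω => by
        change 1 ≤ (K : ℝ) - _
        rw [hcard, le_sub_iff_add_le, add_comm]
        exact_mod_cast hmK
    change ∫ ω, _ ∂(cond (law μ ρ A) {ω | 1 ≤ (K : ℝ) - (rejections (gapRule K m μ ρ c) ω : ℝ)}) ≤ _
    rw [huniv, cond_univ]
    refine hp.integral_le_measureReal (law μ ρ A)
      (f := fun B => ((A \ B).card : ℝ) / ((K : ℝ) - (B.card : ℝ)))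
      (S := {B | 1 ≤ (A \ B).card}) (fun B => ?_) fun B hB => ?_
    · exact div_le_one_of_le₀ (card_sdiff_le_sub A B) (sub_nonneg.2 (card_le_real B))
    · have : (A \ B).card = 0 := by simpa using hB
      simp [this]

/-! ### Asymptotics as the levels vanish -/

theorem tendsto_div_ofReal_of_bounds {X : Type*} {l : Filter X} {h : X → ℝ≥0∞} {y : X → ℝ}
    (hy : ∀ᶠ x in l, 0 < y x)
    (hupper : ∀ s : ℝ, 1 < s → ∀ᶠ x in l, h x ≤ ENNReal.ofReal (s * y x))
    (hlower : ∀ s : ℝ, 0 < s → s < 1 → ∀ᶠ x in l, ENNReal.ofReal (s * y x) ≤ h x) :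
    Tendsto (fun x => h x / ENNReal.ofReal (y x)) l (𝓝 1) := by
  refine tendsto_order.2 ⟨fun a ha => ?_, fun a ha => ?_⟩
  · obtain ⟨s, hs0, has, hs1⟩ := ENNReal.lt_iff_exists_real_btwn.1 ha
    have hs1' : s < 1 := by simpa using (ENNReal.ofReal_lt_one).1 hs1
    have hs0' : 0 < s := ENNReal.ofReal_pos.1 (bot_le.trans_lt has)
    filter_upwards [hy, hlower s hs0' hs1'] with x hx hle
    refine has.trans_le ?_
    rw [ENNReal.le_div_iff_mul_le (Or.inl (ENNReal.ofReal_pos.2 hx).ne')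
      (Or.inl ENNReal.ofReal_ne_top), ← ENNReal.ofReal_mul hs0]
    exact hle
  · obtain ⟨s, hs0, hs1, hsa⟩ := ENNReal.lt_iff_exists_real_btwn.1 ha
    have hs1' : 1 < s := by simpa using (ENNReal.one_lt_ofReal).1 hs1
    filter_upwards [hy, hupper s hs1'] with x hx hle
    refine lt_of_le_of_lt ?_ hsa
    refine ENNReal.div_le_of_le_mul ?_
    rwa [← ENNReal.ofReal_mul hs0]

theorem tendsto_div_comm_one {X : Type*} {l : Filter X} {h y : X → ℝ≥0∞}
    (hy0 : ∀ᶠ x in l, y x ≠ 0) (hy : ∀ᶠ x in l, y x ≠ ⊤)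
    (hlim : Tendsto (fun x => h x / y x) l (𝓝 1)) : Tendsto (fun x => y x / h x) l (𝓝 1) := by
  have := (tendsto_inv_iff.2 hlim)
  rw [inv_one] at this
  refine this.congr' ?_
  filter_upwards [hy0, hy] with x h0 h1
  exact ENNReal.inv_div (Or.inl h1) (Or.inl h0)

theorem tendsto_div_trans_one {X : Type*} {l : Filter X} {f g y : X → ℝ≥0∞}
    (hy0 : ∀ᶠ x in l, y x ≠ 0) (hy : ∀ᶠ x in l, y x ≠ ⊤)
    (hf : Tendsto (fun x => f x / y x) l (𝓝 1)) (hg : Tendsto (fun x => y x / g x) l (𝓝 1)) :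
    Tendsto (fun x => f x / g x) l (𝓝 1) := by
  have := ENNReal.Tendsto.mul hf (Or.inl one_ne_zero) hg (Or.inl one_ne_zero)
  rw [one_mul] at this
  refine this.congr' ?_
  filter_upwards [hy0, hy] with x h0 h1
  rw [div_eq_mul_inv, div_eq_mul_inv, div_eq_mul_inv, ← mul_assoc, mul_assoc (f x),
    ENNReal.inv_mul_cancel h0 h1, mul_one]

theorem eventually_levels {ε : ℝ} (hε : 0 < ε) :
    ∀ᶠ q : ℝ × ℝ in 𝓝[>] 0 ×ˢ 𝓝[>] 0, q.1 ∈ Set.Ioo 0 ε ∧ q.2 ∈ Set.Ioo 0 ε :=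
  prod_mem_prod (Ioo_mem_nhdsGT hε) (Ioo_mem_nhdsGT hε)

theorem tendsto_abs_log_min :
    Tendsto (fun q : ℝ × ℝ => |Real.log (min q.1 q.2)|) (𝓝[>] 0 ×ˢ 𝓝[>] 0) atTop := by
  have hmin : Tendsto (fun q : ℝ × ℝ => min q.1 q.2) (𝓝[>] 0 ×ˢ 𝓝[>] 0) (𝓝[>] 0) := by
    refine tendsto_nhdsWithin_iff.2 ⟨?_, ?_⟩
    · have h1 : Tendsto (fun q : ℝ × ℝ => q.1) (𝓝[>] 0 ×ˢ 𝓝[>] 0) (𝓝 0) :=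
        tendsto_fst.mono_right nhdsWithin_le_nhds
      have h2 : Tendsto (fun q : ℝ × ℝ => q.2) (𝓝[>] 0 ×ˢ 𝓝[>] 0) (𝓝 0) :=
        tendsto_snd.mono_right nhdsWithin_le_nhds
      simpa using h1.min h2
    · filter_upwards [eventually_levels one_pos] with q hq
      exact lt_min hq.1.1 hq.2.1
  exact tendsto_abs_atBot_atTop.comp (Real.tendsto_log_nhdsGT_zero.comp hmin)

theorem log_min_div {α β C : ℝ} (hα : 0 < α) (hβ : 0 < β) (hC : 0 < C) :
    Real.log (min (α / C) (β / C)) = Real.log (min α β) - Real.log C := by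
  rw [min_div_div_right hC.le, Real.log_div (lt_min hα hβ).ne' hC.ne']

theorem one_le_mul_sub {K m : ℕ} (hm : 1 ≤ m) (hmK : m < K) :
    1 ≤ (m : ℝ) * ((K : ℝ) - (m : ℝ)) := by
  have h1 : (1 : ℝ) ≤ m := by exact_mod_cast hm
  have h2 : (m : ℝ) + 1 ≤ K := by exact_mod_cast hmK
  nlinarith

section Metric

variable {K m : ℕ} {μ ρ : ℝ} {MTE : ErrorMetric K} {C₁ C₂ : ℝ}

theorem gapRule_mem_controlClass (hm : 1 ≤ m) (hmK : m < K) (hμ : 0 < μ) (hρ0 : 0 ≤ ρ)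
    (hρ1 : ρ < 1) (hC₁ : 0 < C₁) (hup : GapRuleUpperBound K m μ ρ MTE C₁) {α β : ℝ}
    (hα : 0 < α) (hβ : 0 < β) (hc : 0 < threshold K m C₁ α β) :
    gapRule K m μ ρ (threshold K m C₁ α β) ∈ controlClass MTE (signalClass K m) α β := by
  refine ⟨isSequentialTest_gapRule _ _ _ _ _, fun A hA => ?_⟩
  obtain ⟨h1, h2⟩ := hup A hA _ hc
  have hx : 0 < min (α / C₁) (β / C₁) := lt_min (by positivity) (by positivity)
  have hM := one_le_mul_sub hm hmK
  have hbound : (law μ ρ A).real {ω | (gapRule K m μ ρ (threshold K m C₁ α β)).D ω ≠ A} ≤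
      min (α / C₁) (β / C₁) := by
    refine (law_gapRule_ne_le hm hmK hμ hρ0 hρ1 hA hc).trans ?_
    rw [threshold, neg_add, Real.exp_add, Real.exp_neg (Real.log _), Real.exp_log (by linarith),
      mul_comm, mul_assoc, inv_mul_cancel₀ (by linarith), mul_one]
    -- The bound `exp (-|log x|) ≤ x` holds for every `x > 0`, so levels above `C₁` need no separate
    -- case.
    exact (Real.exp_le_exp.2 (neg_abs_le _)).trans_eq (Real.exp_log hx)
  constructor
  · refine h1.trans ?_
    rw [← le_div_iff₀' hC₁]
    refine (measureReal_mono fun ω hω => ?_).trans (hbound.trans (min_le_left _ _))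
    exact fun h => one_le_falseRejections_iff.1 hω h.subset
  · refine h2.trans ?_
    rw [← le_div_iff₀' hC₁]
    refine (measureReal_mono fun ω hω => ?_).trans (hbound.trans (min_le_right _ _))
    exact fun h => one_le_falseAcceptances_iff.1 hω h.symm.subset

theorem eventually_gapRule_le (hm : 1 ≤ m) (hmK : m < K) (hμ : 0 < μ) (hρ0 : 0 ≤ ρ)
    (hρ1 : ρ < 1) (hC₁ : 0 < C₁) {A : Finset (Fin K)} (hA : A ∈ signalClass K m) {s : ℝ}
    (hs : 1 < s) :
    ∀ᶠ q : ℝ × ℝ in 𝓝[>] 0 ×ˢ 𝓝[>] 0, 0 < threshold K m C₁ q.1 q.2 ∧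
      expectedSampleSize μ ρ A (gapRule K m μ ρ (threshold K m C₁ q.1 q.2)) ≤
        ENNReal.ofReal (s * ((1 - ρ) / μ ^ 2 * |Real.log (min q.1 q.2)|)) := by
  have hsub : 0 < 1 - ρ := sub_pos.2 hρ1
  set k := (1 - ρ) / μ ^ 2 with hk
  have hk0 : 0 < k := by positivity
  -- The slack between `t` and `s` absorbs the bounded terms; taking `δ = μ - μ / t` makes the
  -- leading term of the sample size bound `t k c`.
  set t := (1 + s) / 2 with ht
  have ht1 : 1 < t := by rw [ht]; linarith
  have hts : t < s := by rw [ht]; linarith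
  have ht0 : 0 < t := by linarith
  obtain ⟨C, hC0, hC⟩ := expectedSampleSize_gapRule_le hm hmK hρ0 hρ1
    (δ := μ - μ / t) (sub_pos.2 (div_lt_self hμ ht1)) (sub_lt_self _ (div_pos hμ ht0)) hA
  set C' := |Real.log C₁| + Real.log ((m : ℝ) * ((K : ℝ) - (m : ℝ))) with hC'
  have hlogM : 0 ≤ Real.log ((m : ℝ) * ((K : ℝ) - (m : ℝ))) :=
    Real.log_nonneg (one_le_mul_sub hm hmK)
  filter_upwards [eventually_levels one_pos,
    tendsto_abs_log_min.eventually_ge_atTop ((t * k * C' + C) / (k * (s - t))),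
    tendsto_abs_log_min.eventually_gt_atTop |Real.log C₁|] with q hq hL hL'
  set L := |Real.log (min q.1 q.2)| with hLdef
  have hthr : threshold K m C₁ q.1 q.2 =
      |Real.log (min q.1 q.2) - Real.log C₁| + Real.log ((m : ℝ) * ((K : ℝ) - (m : ℝ))) := by
    rw [threshold, log_min_div hq.1.1 hq.2.1 hC₁]
  have hpos : 0 < threshold K m C₁ q.1 q.2 := by
    have := abs_sub_abs_le_abs_sub (Real.log (min q.1 q.2)) (Real.log C₁)
    rw [hthr]
    linarith
  have hle : threshold K m C₁ q.1 q.2 ≤ L + C' := by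
    have := abs_sub (Real.log (min q.1 q.2)) (Real.log C₁)
    rw [hthr, hC']
    linarith
  refine ⟨hpos, (hC _ hpos).trans (ENNReal.ofReal_le_ofReal ?_)⟩
  have h1 : (1 - ρ) / μ * threshold K m C₁ q.1 q.2 / (μ - (μ - μ / t)) =
      t * k * threshold K m C₁ q.1 q.2 := by
    rw [hk]
    field_simp
    ring
  rw [h1]
  have h2 : t * k * threshold K m C₁ q.1 q.2 ≤ t * k * (L + C') := by gcongr
  rw [div_le_iff₀ (mul_pos hk0 (sub_pos.2 hts))] at hL
  nlinarith

theorem eventually_le_iInf (hm : 1 ≤ m) (hmK : m < K) (hμ : 0 < μ) (hρ0 : 0 ≤ ρ)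
    (hρ1 : ρ < 1) (hC₂ : 0 < C₂) (hlow : UniversalLowerBound K m μ ρ MTE C₂)
    {A : Finset (Fin K)} (hA : A ∈ signalClass K m) {s : ℝ} (hs0 : 0 < s) (hs : s < 1) :
    ∀ᶠ q : ℝ × ℝ in 𝓝[>] 0 ×ˢ 𝓝[>] 0,
      ENNReal.ofReal (s * ((1 - ρ) / μ ^ 2 * |Real.log (min q.1 q.2)|)) ≤
        ⨅ p ∈ controlClass MTE (signalClass K m) q.1 q.2, expectedSampleSize μ ρ A p := by
  have hsub : 0 < 1 - ρ := sub_pos.2 hρ1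
  -- Levels this small give `1 - α / C₂ - β / C₂ ≥ (1 + s) / 2`, and the cap at `1` fixes the sign
  -- of the logarithm.
  have hε : 0 < min 1 (C₂ * ((1 - s) / 4)) :=
    lt_min one_pos (mul_pos hC₂ (by linarith))
  filter_upwards [eventually_levels hε,
    tendsto_abs_log_min.eventually_ge_atTop ((1 + |Real.log C₂|) / ((1 - s) / 2)),
    tendsto_abs_log_min.eventually_ge_atTop |Real.log C₂|] with q hq hL hL'
  obtain ⟨⟨hα, hα'⟩, hβ, hβ'⟩ := hq
  rw [lt_min_iff] at hα' hβ'
  refine le_iInf₂ fun p hp => ?_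
  have hF : ∀ B ∈ signalClass K m,
      (FWER K μ ρ).type1 B p ≤ q.1 / C₂ ∧ (FWER K μ ρ).type2 B p ≤ q.2 / C₂ := by
    intro B hB
    obtain ⟨h1, h2⟩ := hlow B hB p hp.1
    obtain ⟨h3, h4⟩ := hp.2 B hB
    exact ⟨(le_div_iff₀' hC₂).2 (h1.trans h3), (le_div_iff₀' hC₂).2 (h2.trans h4)⟩
  have ha : q.1 / C₂ ≤ (1 - s) / 4 := by
    rw [div_le_iff₀' hC₂]
    exact hα'.2.le
  have hb : q.2 / C₂ ≤ (1 - s) / 4 := by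
    rw [div_le_iff₀' hC₂]
    exact hβ'.2.le
  refine le_trans (ENNReal.ofReal_le_ofReal ?_) (le_expectedSampleSize hm hmK hμ hρ0 hρ1 hA hp.1
    (div_pos hα hC₂) (div_pos hβ hC₂) ((min_le_left _ _).trans (by linarith)) hF)
  rw [Real.log_inv, log_min_div hα hβ hC₂]
  have hneg : Real.log (min q.1 q.2) ≤ 0 :=
    Real.log_nonpos (lt_min hα hβ).le ((min_le_left _ _).trans hα'.1.le)
  rw [abs_of_nonpos hneg] at hL hL' ⊢
  rw [div_le_iff₀ (by linarith)] at hL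
  set L := -Real.log (min q.1 q.2)
  have hlogL : -(Real.log (min q.1 q.2) - Real.log C₂) = L + Real.log C₂ := by ring
  rw [hlogL, mul_left_comm]
  refine mul_le_mul_of_nonneg_left ?_ (by positivity)
  have habs := neg_abs_le (Real.log C₂)
  have h1 : (1 + s) / 2 * (L + Real.log C₂) ≤
      (1 - q.1 / C₂ - q.2 / C₂) * (L + Real.log C₂) :=
    mul_le_mul_of_nonneg_right (by linarith) (by linarith)
  -- Since `(1 + s) / 2 ≤ 1`, the loss is at most `1 + |log C₂|`, which `hL` bounds by `L (1 - s) /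
  -- 2`.
  nlinarith [abs_nonneg (Real.log C₂)]

end Metric

end SeqMTE

theorem theorem5p1 (K m : ℕ) (hm : 1 ≤ m) (hmK : m < K) (μ ρ : ℝ) (hμ : 0 < μ)
    (hρ0 : 0 < ρ) (hρ1 : ρ < 1) :
    (∀ (MTE : ErrorMetric K) (C₁ C₂ : ℝ), 0 < C₁ → 0 < C₂ →
      GapRuleUpperBound K m μ ρ MTE C₁ → UniversalLowerBound K m μ ρ MTE C₂ →
      (∀ α ∈ Set.Ioo (0 : ℝ) 1, ∀ β ∈ Set.Ioo (0 : ℝ) 1, 0 < threshold K m C₁ α β →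
        gapRule K m μ ρ (threshold K m C₁ α β) ∈ controlClass MTE (signalClass K m) α β) ∧
      (∀ A ∈ signalClass K m,
        AsympEquiv
          (fun α β => expectedSampleSize μ ρ A (gapRule K m μ ρ (threshold K m C₁ α β)))
          (fun α β => ENNReal.ofReal ((1 - ρ) / μ ^ 2 * |Real.log (min α β)|)) ∧
        AsympEquiv
          (fun α β => ENNReal.ofReal ((1 - ρ) / μ ^ 2 * |Real.log (min α β)|))
          (fun α β => ⨅ p ∈ controlClass MTE (signalClass K m) α β,
            expectedSampleSize μ ρ A p) ∧
        AsympEquiv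
          (fun α β => expectedSampleSize μ ρ A (gapRule K m μ ρ (threshold K m C₁ α β)))
          (fun α β => ⨅ p ∈ controlClass MTE (signalClass K m) α β,
            expectedSampleSize μ ρ A p))) ∧
    (GapRuleUpperBound K m μ ρ (FDR_FNR K μ ρ) 1 ∧
      UniversalLowerBound K m μ ρ (FDR_FNR K μ ρ) (1 / (K : ℝ))) ∧
    (GapRuleUpperBound K m μ ρ (pFDR_pFNR K μ ρ) 1 ∧
      UniversalLowerBound K m μ ρ (pFDR_pFNR K μ ρ) (1 / (K : ℝ))) := by
  have hK : 1 ≤ K := by omega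
  refine ⟨fun MTE C₁ C₂ hC₁ hC₂ hup hlow => ⟨?_, ?_⟩,
    ⟨FDR_FNR_gapRuleUpperBound K m μ ρ, FDR_FNR_universalLowerBound K m hK μ ρ⟩,
    ⟨pFDR_pFNR_gapRuleUpperBound hm hmK μ ρ, pFDR_pFNR_universalLowerBound K m μ ρ⟩⟩
  · intro α hα β hβ hc
    exact gapRule_mem_controlClass hm hmK hμ hρ0.le hρ1 hC₁ hup hα.1 hβ.1 hc
  intro A hA
  set f : ℝ × ℝ → ℝ≥0∞ := fun q =>
    expectedSampleSize μ ρ A (gapRule K m μ ρ (threshold K m C₁ q.1 q.2))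
  set g : ℝ × ℝ → ℝ≥0∞ := fun q =>
    ⨅ p ∈ controlClass MTE (signalClass K m) q.1 q.2, expectedSampleSize μ ρ A p
  set y : ℝ × ℝ → ℝ := fun q => (1 - ρ) / μ ^ 2 * |Real.log (min q.1 q.2)|
  have hy : ∀ᶠ q in 𝓝[>] 0 ×ˢ 𝓝[>] 0, 0 < y q := by
    filter_upwards [tendsto_abs_log_min.eventually_gt_atTop 0] with q hq
    have := sub_pos.2 hρ1
    positivity
  -- Membership needs a positive threshold, which holds once the levels are small.
  have hgf : ∀ᶠ q in 𝓝[>] 0 ×ˢ 𝓝[>] 0, g q ≤ f q := by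
    filter_upwards [eventually_gapRule_le hm hmK hμ hρ0.le hρ1 hC₁ hA one_lt_two,
      eventually_levels one_pos] with q hq hq'
    exact iInf₂_le _
      (gapRule_mem_controlClass hm hmK hμ hρ0.le hρ1 hC₁ hup hq'.1.1 hq'.2.1 hq.1)
  have hupper : ∀ s : ℝ, 1 < s → ∀ᶠ q in 𝓝[>] 0 ×ˢ 𝓝[>] 0, f q ≤ ENNReal.ofReal (s * y q) :=
    fun s hs => (eventually_gapRule_le hm hmK hμ hρ0.le hρ1 hC₁ hA hs).mono fun _ h => h.2
  have hlower : ∀ s : ℝ, 0 < s → s < 1 →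
      ∀ᶠ q in 𝓝[>] 0 ×ˢ 𝓝[>] 0, ENNReal.ofReal (s * y q) ≤ g q :=
    fun s hs0 hs => eventually_le_iInf hm hmK hμ hρ0.le hρ1 hC₂ hlow hA hs0 hs
  have hf := tendsto_div_ofReal_of_bounds hy hupper fun s h0 h1 =>
    ((hlower s h0 h1).and hgf).mono fun _ h => h.1.trans h.2
  have hg := tendsto_div_ofReal_of_bounds hy
    (fun s h1 => ((hupper s h1).and hgf).mono fun _ h => h.2.trans h.1) hlower
  have hy0 : ∀ᶠ q in 𝓝[>] 0 ×ˢ 𝓝[>] 0, ENNReal.ofReal (y q) ≠ 0 :=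
    hy.mono fun _ h => (ENNReal.ofReal_pos.2 h).ne'
  have hytop : ∀ᶠ q in 𝓝[>] 0 ×ˢ 𝓝[>] (0 : ℝ), ENNReal.ofReal (y q) ≠ ⊤ :=
    Eventually.of_forall fun _ => ENNReal.ofReal_ne_top
  have hg' := tendsto_div_comm_one hy0 hytop hg
  exact ⟨hf, hg', tendsto_div_trans_one hy0 hytop hf hg'⟩
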